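/- **Model.** An insertion-only stream over $[n]$ is a sequence of updates $(i_t,\Delta_t)\in[n]\times\{0,1,\dots,M\}$; its frequency vector $\mathcal X\in\mathbb Z_{\ge 0}^n$ has the coordinates $\mathcal X_i=\sum_{t:\,i_t=i}\Delta_t$. For $\mathcal X\ne 0$, the empirical Shannon entropy is $H(\mathcal X)=\sum_{i:\,\mathcal X_i\neq 0} p_i\log(1/p_i)$ with $p_i=\mathcal X_i/\|\mathcal X\|_1$ (natural logarithm). A streaming algorithm with $s$ bits of space in the random-oracle model has a memory of $s$ bits. It starts from a fixed memory content, and at each update it replaces the content by a function of the old content, the update, a string of random bits (the oracle: of arbitrary finite length, drawn once before the stream, always available and not charged as space), and a number of fresh random bits tossed for this update. After the last update it outputs a real number, a function of the oracle and the memory content. All random bits are independent and fair, and computation is not charged. Space is thus measured between updates. **Theorem.** For every $c\in\mathbb N$ there is a constant $C>0$ such that the following holds for all integers $n\ge 3$ and $0\le m,M\le n^c$ and all real $0<\epsilon<1$. There is a streaming algorithm in the random-oracle model (which may depend on $n,m,M,\epsilon$) that uses at most $$C\cdot\frac1{\epsilon^{2}}\Bigl(\log\log n+\log\frac1\epsilon\Bigr)$$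 bits of space and such that, for every fixed insertion-only stream over $[n]$ of length at most $m$ with increments in $\{0,\dots,M\}$ and frequency vector $\mathcal X\ne0$, its output $\tilde H$ satisfies $|\tilde H-H(\mathcal X)|\le\epsilon$ with probability at least $3/4$. -/

import Mathlib

namespace EntropyStream

/-- An insertion-only update `(i, Δ)` with `i ∈ [n]` and `Δ ∈ {0, …, M}`. -/
abbrev Update (n M : ℕ) : Type := Fin n × Fin (M + 1)

/-- The frequency vector of the stream `σ 0, …, σ (L - 1)`: coordinate `i` is the sum of all
increments `Δ` of the updates `(i, Δ)` in the stream. -/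
def freq {n M L : ℕ} (σ : Fin L → Update n M) (i : Fin n) : ℕ :=
  ∑ t : Fin L, if (σ t).1 = i then ((σ t).2 : ℕ) else 0

/-- The `ℓ₁` norm of a vector with non-negative integer entries. -/
def l1 {n : ℕ} (x : Fin n → ℕ) : ℕ := ∑ i, x i

/-- The empirical Shannon entropy `∑ᵢ pᵢ log (1 / pᵢ)` with `pᵢ = xᵢ / ‖x‖₁` (natural logarithm).
Coordinates with `xᵢ = 0` contribute `0`. -/
noncomputable def entropy {n : ℕ} (x : Fin n → ℕ) : ℝ :=
  ∑ i, ((x i : ℝ) / (l1 x : ℝ)) * Real.log ((l1 x : ℝ) / (x i : ℝ))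

/-- Strings of `k` bits. -/
abbrev Bits (k : ℕ) : Type := Fin k → Bool

/-- A randomized streaming algorithm with `s` bits of memory in the random-oracle model, for
insertion-only streams over `[n]` with increments at most `M`.

* The random oracle is a string of `oracleLen` random bits, drawn once before the stream. It may be
  arbitrarily long, can be consulted during every update and when the output is computed, and is not
  charged as memory.
* While an update is processed, the algorithm may in addition toss `coinLen` fresh coins. They are
  gone afterwards, unless the algorithm keeps them in its memory.
* All that passes from one update to the next is the content of the memory, a string of `s` bits. In
  particular the algorithm is not told how many updates it has seen. -/
structure Algorithm (n M s : ℕ) where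
  /-- The number of bits of the random oracle. -/
  oracleLen : ℕ
  /-- The number of fresh coins per update. -/
  coinLen : ℕ
  /-- The initial content of the memory. -/
  init : Bits s
  /-- The new content of the memory, from the oracle, the fresh coins, the old content and the
  update. -/
  update : Bits oracleLen → Bits coinLen → Bits s → Update n M → Bits s
  /-- The estimate, from the oracle and the final content of the memory. -/
  output : Bits oracleLen → Bits s → ℝ

namespace Algorithm

variable {n M s : ℕ}

/-- The outcomes of all random bits in a run on a stream of length `L`: the oracle, and the fresh
coins of each of the `L` updates. -/
abbrev Randomness (A : Algorithm n M s) (L : ℕ) : Type :=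
  Bits A.oracleLen × (Fin L → Bits A.coinLen)

/-- The content of the memory after the stream `σ` has been read, in order. -/
def finalState (A : Algorithm n M s) {L : ℕ} (ρ : A.Randomness L) (σ : Fin L → Update n M) :
    Bits s :=
  Fin.foldl L (fun state t => A.update ρ.1 (ρ.2 t) state (σ t)) A.init

/-- The estimate that the algorithm outputs at the end of the stream `σ`. -/
def estimate (A : Algorithm n M s) {L : ℕ} (ρ : A.Randomness L) (σ : Fin L → Update n M) : ℝ :=
  A.output ρ.1 (A.finalState ρ σ)

/-- The probability of an event when all random bits are independent and fair, that is, when the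
outcome `ρ` is uniformly distributed. -/
noncomputable def prob (A : Algorithm n M s) {L : ℕ} (E : Set (A.Randomness L)) : ℝ :=
  (Nat.card E : ℝ) / (Nat.card (A.Randomness L) : ℝ)

end Algorithm

end EntropyStream

namespace EntropyStream

open Finset BigOperators

/-! Entropy is read off a Laplace transform. If `r` is uniform in `{1, …, R}`, the discretized
Pareto variable `⌊R / r⌋` has a Laplace transform whose logarithm at small `z` is close to `z log
z`. The oracle gives every coordinate the sum of `N` independent such variables as its weight. Let
`F` be the `ℓ₁` norm and `Y` the weighted sum of the coordinates divided by `N F`. Summing `N z log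
z` over `z = a xᵢ / (N F)` gives `E exp(-a Y) ≈ exp(a (log a - H - log N))`
(`expect_exp_neg_sketch_eq`). At `a = 1` this is `μ = exp(-H - log N)`; at `a = 2` it shows that the
second moment is only about `4 μ²`. By Chebyshev the mean of `O(1/ε²)` copies of `exp(-Y)`
determines `μ` up to a factor `1 + O(ε)`, and `-log` turns this into an additive error in `H`
(`expect_sketch_bad_le`).

The weights cost no space, but the sketches and `F` must be maintained. Each is a sum of nonnegative
increments, kept as a floating-point number with unbiased randomized rounding. The relative variance
is at most `2 / 2 ^ β` for `β` mantissa bits, whatever the stream length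
(`expect_counter_sub_sq_le`). Values `Y` beyond order `log n + log (1/ε)` contribute negligibly to
the mean, so relative precision of order `ε / (log n + log (1/ε))` suffices
(`abs_log_average_sub_le`). Mantissa and exponent then take `O(log log n + log (1/ε))` bits per
counter. -/

/-! ### Randomized rounding and floating-point counters -/

theorem sum_range_mul_mod (f : ℕ → ℝ) (d q : ℕ) :
    ∑ u ∈ range (d * q), f (u % d) = q * ∑ u ∈ range d, f u := by
  induction q with
  | zero => simp
  | succ q ih =>
    rw [Nat.mul_succ, sum_range_add, ih]
    have h : ∑ x ∈ range d, f ((d * q + x) % d) = ∑ x ∈ range d, f x :=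
      sum_congr rfl fun x hx => by
        rw [Nat.mul_add_mod, Nat.mod_eq_of_lt (mem_range.1 hx)]
    rw [h]; push_cast; ring

theorem sum_range_add_div (f : ℕ → ℝ) {d : ℕ} (hd : 0 < d) (v : ℕ) :
    ∑ u ∈ range d, f ((v + u) / d)
      = ((d : ℝ) - (v % d : ℕ)) * f (v / d) + (v % d : ℕ) * f (v / d + 1) := by
  have hr : v % d < d := Nat.mod_lt _ hd
  have hv : d * (v / d) + v % d = v := Nat.div_add_mod v d
  have hsplit : d = (d - v % d) + v % d := by omega
  have h1 : ∀ u ∈ range (d - v % d), f ((v + u) / d) = f (v / d) := by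
    intro u hu
    have hu' := mem_range.1 hu
    congr 1
    have : v + u = v % d + u + d * (v / d) := by omega
    rw [this, Nat.add_mul_div_left _ _ hd, Nat.div_eq_of_lt (by omega)]
    omega
  have h2 : ∀ u ∈ range (v % d), f ((v + (d - v % d + u)) / d) = f (v / d + 1) := by
    intro u hu
    have hu' := mem_range.1 hu
    congr 1
    have : v + (d - v % d + u) = u + d * (v / d + 1) := by
      rw [Nat.mul_succ]; omega
    rw [this, Nat.add_mul_div_left _ _ hd, Nat.div_eq_of_lt (by omega)]
    omega
  have h3 : ∑ u ∈ range d, f ((v + u) / d)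
      = ∑ u ∈ range (d - v % d + v % d), f ((v + u) / d) := by rw [← hsplit]
  rw [h3, sum_range_add, sum_congr rfl h1, sum_congr rfl h2, sum_const, sum_const, card_range,
    card_range, nsmul_eq_mul, nsmul_eq_mul, Nat.cast_sub hr.le]

/-- The exponent used for writing `v` as a floating-point number with `β` mantissa bits; numbers
from `2 ^ (β + E)` on are kept exactly. -/
def expo (β E v : ℕ) : ℕ := if v < 2 ^ (β + E) then v.size - β else 0

/-- Randomized rounding to a floating-point number, with randomness `u`. -/
def rnd (β E v u : ℕ) : ℕ :=
  (v + u % 2 ^ expo β E v) / 2 ^ expo β E v * 2 ^ expo β E v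

theorem expo_le (β E v : ℕ) : expo β E v ≤ E := by
  unfold expo
  split_ifs with h
  · have := Nat.size_le.2 h
    omega
  · omega

theorem lt_two_pow_expo {β E v : ℕ} (hv : v < 2 ^ (β + E)) : v < 2 ^ (β + expo β E v) := by
  rw [← Nat.size_le, expo, if_pos hv]
  omega

theorem two_pow_expo_le {β E v : ℕ} (hβ : 1 ≤ β) (h : 0 < expo β E v) :
    2 ^ (β - 1) * 2 ^ expo β E v ≤ v := by
  rw [← pow_add, ← Nat.lt_size]
  unfold expo at *
  split_ifs at * <;> omega

/-- Adding a uniform offset before truncating rounds up with probability equal to the fractional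
part. Randomness from `Fin (2 ^ E)` serves all exponents, since `2 ^ expo β E v` divides `2 ^ E`. -/
theorem expect_rnd (β E v : ℕ) (f : ℕ → ℝ) :
    𝔼 u : Fin (2 ^ E), f (rnd β E v u)
      = (((2 ^ expo β E v : ℕ) : ℝ) - (v % 2 ^ expo β E v : ℕ)) / (2 ^ expo β E v : ℕ)
          * f (v / 2 ^ expo β E v * 2 ^ expo β E v)
        + (v % 2 ^ expo β E v : ℕ) / (2 ^ expo β E v : ℕ)
          * f ((v / 2 ^ expo β E v + 1) * 2 ^ expo β E v) := by
  unfold rnd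
  set e := expo β E v with he
  have hpos : 0 < 2 ^ e := by positivity
  have hE : 2 ^ E = 2 ^ e * 2 ^ (E - e) := by
    rw [← pow_add]; congr 1; have := expo_le β E v; omega
  have hsum : ∑ u : Fin (2 ^ E), f ((v + (u : ℕ) % 2 ^ e) / 2 ^ e * 2 ^ e)
      = (2 ^ (E - e) : ℕ) * ∑ u ∈ range (2 ^ e), f ((v + u) / 2 ^ e * 2 ^ e) := by
    rw [← sum_range_mul_mod (fun u => f ((v + u) / 2 ^ e * 2 ^ e)), ← hE,
      Finset.sum_range]
  rw [Fintype.expect_eq_sum_div_card, hsum,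
    sum_range_add_div (fun q => f (q * 2 ^ e)) hpos, Fintype.card_fin, hE, Nat.cast_mul]
  have h1 : ((2 ^ e : ℕ) : ℝ) ≠ 0 := by positivity
  have h2 : ((2 ^ (E - e) : ℕ) : ℝ) ≠ 0 := by positivity
  field_simp

theorem expect_rnd_id (β E v : ℕ) : 𝔼 u : Fin (2 ^ E), (rnd β E v u : ℝ) = v := by
  rw [expect_rnd β E v (fun x => (x : ℝ))]
  have h := Nat.div_add_mod v (2 ^ expo β E v)
  set d := 2 ^ expo β E v
  have hd : ((d : ℕ) : ℝ) ≠ 0 := by positivity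
  have h' : (v : ℝ) = d * (v / d : ℕ) + (v % d : ℕ) := by exact_mod_cast h.symm
  push_cast at *
  rw [h']
  field_simp
  ring

/-- Floating-point numbers with `β` mantissa bits, and all numbers from `2 ^ (β + E)` on. -/
def IsFloat (β E a : ℕ) : Prop :=
  (∃ q e, q ≤ 2 ^ β ∧ e ≤ E ∧ a = q * 2 ^ e) ∨ 2 ^ (β + E) ≤ a

theorem isFloat_zero (β E : ℕ) : IsFloat β E 0 := Or.inl ⟨0, 0, by simp⟩

theorem isFloat_rnd (β E v u : ℕ) : IsFloat β E (rnd β E v u) := by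
  by_cases hv : v < 2 ^ (β + E)
  · refine Or.inl ⟨_, expo β E v, ?_, expo_le β E v, rfl⟩
    have h1 := lt_two_pow_expo hv
    have hpos : 0 < 2 ^ expo β E v := by positivity
    have h2 := Nat.mod_lt u hpos
    rw [← Nat.lt_succ_iff, Nat.div_lt_iff_lt_mul hpos]
    rw [pow_add] at h1
    rw [Nat.succ_mul]
    omega
  · right
    have : expo β E v = 0 := if_neg hv
    simp only [rnd, this, pow_zero, Nat.mod_one, Nat.div_one]
    omega

/-- A float with a coarser exponent lies on the rounding grid of `v`. One with a finer exponent is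
at most `2 ^ (β - 1) * 2 ^ expo β E v`, a grid point below `v`. Hence rounding never goes below the
previous counter content. -/
theorem le_floor_of_isFloat {β E a v : ℕ} (hβ : 1 ≤ β) (ha : IsFloat β E a) (hav : a ≤ v) :
    a ≤ v / 2 ^ expo β E v * 2 ^ expo β E v := by
  rcases ha with ⟨q, e', hq, -, rfl⟩ | ha
  · rcases le_or_gt (expo β E v) e' with h | h
    · obtain ⟨m, rfl⟩ := Nat.exists_eq_add_of_le h
      have hpos : 0 < 2 ^ expo β E v := by positivity
      have : q * 2 ^ (expo β E v + m) = q * 2 ^ m * 2 ^ expo β E v := by rw [pow_add]; ring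
      rw [this] at hav ⊢
      exact Nat.mul_le_mul_right _ ((Nat.le_div_iff_mul_le hpos).2 hav)
    · have hpos : 0 < 2 ^ expo β E v := by positivity
      have h1 := two_pow_expo_le (β := β) (E := E) (v := v) hβ (by omega)
      refine le_trans ?_ (Nat.mul_le_mul_right _ ((Nat.le_div_iff_mul_le hpos).2 h1))
      calc q * 2 ^ e' ≤ 2 ^ β * 2 ^ e' := Nat.mul_le_mul_right _ hq
        _ = 2 ^ (β + e') := by rw [pow_add]
        _ ≤ 2 ^ (β - 1 + expo β E v) := Nat.pow_le_pow_right (by norm_num) (by omega)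
        _ = _ := by rw [pow_add]
  · have : expo β E v = 0 := if_neg (by omega)
    simpa [this] using hav

/-- With grid width `d` and remainder `r`, the rounding variance is `r (d - r) ≤ d r`. Here `r ≤ w`,
because the float `a` does not exceed the truncation of `a + w`, and `d` is at most `2 / 2 ^ β`
times `a + w`. The factor `w` makes the variances summable over a stream of any length. -/
theorem expect_rnd_sq_le {β E a w : ℕ} (hβ : 1 ≤ β) (ha : IsFloat β E a) :
    𝔼 u : Fin (2 ^ E), (rnd β E (a + w) u : ℝ) ^ 2
      ≤ ((a + w : ℕ) : ℝ) ^ 2 + 2 / 2 ^ β * w * (a + w : ℕ) := by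
  rw [expect_rnd β E (a + w) (fun x => (x : ℝ) ^ 2)]
  have h := Nat.div_add_mod (a + w) (2 ^ expo β E (a + w))
  have hlo := le_floor_of_isFloat (v := a + w) hβ ha (by omega)
  have hexp := @two_pow_expo_le β E (a + w) hβ
  have hmod : 0 < expo β E (a + w) ∨ (a + w) % 2 ^ expo β E (a + w) = 0 := by
    rcases Nat.eq_zero_or_pos (expo β E (a + w)) with h0 | h0
    · right; rw [h0, pow_zero, Nat.mod_one]
    · exact Or.inl h0
  set v := a + w with hv
  set e := expo β E v
  set d := 2 ^ e with hd_def
  have hd : (0 : ℝ) < d := by positivity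
  have hr : v % d ≤ w := by
    rw [mul_comm] at hlo
    omega
  have h' : (v : ℝ) = d * (v / d : ℕ) + (v % d : ℕ) := by exact_mod_cast h.symm
  have key : (d : ℝ) * (v % d : ℕ) ≤ 2 / 2 ^ β * w * v := by
    rcases hmod with hm | hm
    · have h1 : ((2 ^ (β - 1) * d : ℕ) : ℝ) ≤ v := by exact_mod_cast hexp hm
      have h2 : (2 : ℝ) ^ β = 2 * 2 ^ (β - 1) := by
        rw [← pow_succ']; congr 1; omega
      push_cast at h1
      have h3 : (d : ℝ) ≤ 2 / 2 ^ β * v := by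
        rw [h2]
        field_simp
        linarith
      calc (d : ℝ) * (v % d : ℕ) ≤ (2 / 2 ^ β * v) * w := by
            apply mul_le_mul h3 (by exact_mod_cast hr) (by positivity) (by positivity)
        _ = _ := by ring
    · rw [hm]; simp; positivity
  have hr0 : (0 : ℝ) ≤ (v % d : ℕ) := by positivity
  generalize ((v % d : ℕ) : ℝ) = r at *
  generalize hqq : ((v / d : ℕ) : ℝ) = q at *
  push_cast
  rw [hqq]
  have : ((d : ℝ) - r) / d * (q * d) ^ 2 + r / d * ((q + 1) * d) ^ 2
      = (v : ℝ) ^ 2 + d * r - r ^ 2 := by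
    rw [h']; field_simp; ring
  rw [this]
  nlinarith [sq_nonneg r]

theorem expect_finCons {Ω : Type*} [Fintype Ω] {L : ℕ} (F : (Fin (L + 1) → Ω) → ℝ) :
    𝔼 u, F u = 𝔼 x : Ω, 𝔼 u : Fin L → Ω, F (Fin.cons x u) := by
  rw [← Fintype.expect_equiv (Fin.consEquiv (fun _ : Fin (L + 1) => Ω))
    (fun p => F (Fin.cons p.1 p.2)) F (fun p => rfl), ← Finset.univ_product_univ,
    Finset.expect_product]

/-- The value of a floating-point counter, started at `a`, after the increments `w`, when the
rounding uses the randomness `u`. -/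
def counter (β E : ℕ) {L : ℕ} (w : Fin L → ℕ) (u : Fin L → Fin (2 ^ E)) (a : ℕ) : ℕ :=
  Fin.foldl L (fun a t => rnd β E (a + w t) (u t)) a

theorem counter_cons (β E : ℕ) {L : ℕ} (w : Fin (L + 1) → ℕ) (x : Fin (2 ^ E))
    (u : Fin L → Fin (2 ^ E)) (a : ℕ) :
    counter β E w (Fin.cons x u : Fin (L + 1) → Fin (2 ^ E)) a
      = counter β E (fun t => w t.succ) u (rnd β E (a + w 0) x) := by
  simp [counter, Fin.foldl_succ]

theorem expect_counter (β E : ℕ) {L : ℕ} (w : Fin L → ℕ) (a : ℕ) :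
    𝔼 u, (counter β E w u a : ℝ) = a + ∑ t, (w t : ℝ) := by
  induction L generalizing a with
  | zero => simp [counter]
  | succ L ih =>
    rw [expect_finCons]
    simp_rw [counter_cons, ih, Finset.expect_add_distrib, Fintype.expect_const]
    rw [expect_rnd_id, Fin.sum_univ_succ]
    push_cast; ring

theorem expect_counter_sq_le {β E L : ℕ} (hβ : 1 ≤ β) (w : Fin L → ℕ) {a : ℕ}
    (ha : IsFloat β E a) :
    𝔼 u, (counter β E w u a : ℝ) ^ 2
      ≤ (a + ∑ t, (w t : ℝ)) ^ 2 + 2 / 2 ^ β * (∑ t, (w t : ℝ)) * (a + ∑ t, (w t : ℝ)) := by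
  induction L generalizing a with
  | zero => simp [counter]
  | succ L ih =>
    rw [expect_finCons]
    simp_rw [counter_cons]
    rw [Fin.sum_univ_succ]
    set δ : ℝ := 2 / 2 ^ β
    have hδ : 0 ≤ δ := by positivity
    set S : ℝ := ∑ t : Fin L, (w t.succ : ℝ) with hS
    have hS0 : 0 ≤ S := by positivity
    have h1 : 𝔼 x : Fin (2 ^ E), 𝔼 u : Fin L → Fin (2 ^ E),
        (counter β E (fun t => w t.succ) u (rnd β E (a + w 0) x) : ℝ) ^ 2
        ≤ 𝔼 x : Fin (2 ^ E), ((rnd β E (a + w 0) x : ℝ) ^ 2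
          + (2 * S + δ * S) * (rnd β E (a + w 0) x : ℝ) + (S ^ 2 + δ * S ^ 2)) := by
      refine Finset.expect_le_expect fun x _ => ?_
      refine (ih (fun t => w t.succ) (isFloat_rnd β E (a + w 0) x)).trans (le_of_eq ?_)
      simp only [← hS]
      ring
    refine h1.trans ?_
    rw [Finset.expect_add_distrib, Finset.expect_add_distrib, Fintype.expect_const,
      ← Finset.mul_expect, expect_rnd_id]
    have h2 := expect_rnd_sq_le (w := w 0) hβ ha
    push_cast at h2 ⊢
    have : (0 : ℝ) ≤ w 0 := by positivity
    -- This is exactly the slack between the two sides of the induction step.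
    have : 0 ≤ δ * w 0 * S := by positivity
    change _ ≤ _ + δ * _ * _ at h2
    nlinarith

theorem expect_counter_sub_sq_le {β E L : ℕ} (hβ : 1 ≤ β) (w : Fin L → ℕ) :
    𝔼 u, ((counter β E w u 0 : ℝ) - ∑ t, (w t : ℝ)) ^ 2 ≤ 2 / 2 ^ β * (∑ t, (w t : ℝ)) ^ 2 := by
  have h1 := expect_counter β E w 0
  have h2 := expect_counter_sq_le hβ w (isFloat_zero β E)
  set S : ℝ := ∑ t, (w t : ℝ)
  have : ∀ u, ((counter β E w u 0 : ℝ) - S) ^ 2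
      = (counter β E w u 0 : ℝ) ^ 2 + (-2 * S) * (counter β E w u 0 : ℝ) + S ^ 2 := by
    intro u; ring
  simp_rw [this]
  rw [Finset.expect_add_distrib, Finset.expect_add_distrib, Fintype.expect_const,
      ← Finset.mul_expect, h1]
  push_cast at h2 ⊢
  nlinarith

theorem expect_ite_lt_abs_le {Ω : Type*} [Fintype Ω] (X : Ω → ℝ) {t v : ℝ} (ht : 0 < t)
    (hX : 𝔼 ω, X ω ^ 2 ≤ v) : 𝔼 ω, (if t < |X ω| then (1 : ℝ) else 0) ≤ v / t ^ 2 := by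
  rw [le_div_iff₀ (by positivity), Finset.expect_mul]
  refine le_trans (Finset.expect_le_expect fun ω _ => ?_) hX
  split_ifs with h
  · rw [one_mul, ← sq_abs (X ω)]
    gcongr
  · rw [zero_mul]; positivity

theorem expect_counter_bad_le {β E L : ℕ} (hβ : 1 ≤ β) (w : Fin L → ℕ) {η : ℝ} (hη : 0 < η)
    (hS : 0 < ∑ t, w t) :
    𝔼 u, (if η * ∑ t, (w t : ℝ) < |(counter β E w u 0 : ℝ) - ∑ t, (w t : ℝ)| then (1 : ℝ) else 0)
      ≤ 2 / 2 ^ β / η ^ 2 := by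
  have hS' : 0 < ∑ t, (w t : ℝ) := by exact_mod_cast hS
  refine (expect_ite_lt_abs_le _ (by positivity) (expect_counter_sub_sq_le hβ w)).trans
    (le_of_eq ?_)
  field_simp

/-! ### Saturating counters with finitely many states -/

theorem rnd_of_le {β E v : ℕ} (h : 2 ^ (β + E) ≤ v) (u : ℕ) : rnd β E v u = v := by
  have : expo β E v = 0 := if_neg (by omega)
  simp [rnd, this, Nat.mod_one]

/-- Beyond the cap the ideal counter is exact and never decreases, so truncating at every step
equals truncating once at the end. The moment bounds can thus be proved without saturation. -/
theorem foldl_min_eq_min_counter (β E : ℕ) {L : ℕ} (w : Fin L → ℕ) (u : Fin L → Fin (2 ^ E))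
    (a : ℕ) :
    Fin.foldl L (fun a t => min (rnd β E (a + w t) (u t)) (2 ^ (β + E))) (min a (2 ^ (β + E)))
      = min (counter β E w u a) (2 ^ (β + E)) := by
  unfold counter
  induction L generalizing a with
  | zero => simp
  | succ L ih =>
    rw [Fin.foldl_succ, Fin.foldl_succ, ← ih]
    congr 1
    rcases le_total a (2 ^ (β + E)) with h | h
    · rw [min_eq_left h]
    · rw [min_eq_right h, rnd_of_le (by omega), rnd_of_le (by omega)]
      omega

/-- The contents of a floating-point counter that saturates at `2 ^ (β + E)`. -/
abbrev CounterState (β E : ℕ) : Type := {a : ℕ // a ≤ 2 ^ (β + E) ∧ IsFloat β E a}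

theorem exists_float_of_le {β E a : ℕ} (h : a ≤ 2 ^ (β + E)) (ha : IsFloat β E a) :
    ∃ q : Fin (2 ^ β + 1), ∃ e : Fin (E + 1), (q : ℕ) * 2 ^ (e : ℕ) = a := by
  rcases ha with ⟨q, e, hq, he, rfl⟩ | ha
  · exact ⟨⟨q, by omega⟩, ⟨e, by omega⟩, rfl⟩
  · exact ⟨⟨2 ^ β, by omega⟩, ⟨E, by omega⟩, by
      rw [← pow_add]; exact le_antisymm ha h⟩

/-- The counter content with mantissa `q` and exponent `e`. -/
def CounterState.ofFloat (β E : ℕ) (p : Fin (2 ^ β + 1) × Fin (E + 1)) : CounterState β E :=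
  ⟨p.1 * 2 ^ (p.2 : ℕ), by
    rw [pow_add]
    exact Nat.mul_le_mul (by omega) (Nat.pow_le_pow_right (by norm_num) (by omega)),
    Or.inl ⟨p.1, p.2, by omega, by omega, rfl⟩⟩

theorem CounterState.ofFloat_surjective (β E : ℕ) :
    Function.Surjective (CounterState.ofFloat β E) := by
  rintro ⟨a, h, ha⟩
  obtain ⟨q, e, hqe⟩ := exists_float_of_le h ha
  exact ⟨(q, e), Subtype.ext hqe⟩

noncomputable instance (β E : ℕ) : Fintype (CounterState β E) :=
  Fintype.ofSurjective _ (CounterState.ofFloat_surjective β E)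

theorem card_counterState_le (β E : ℕ) :
    Fintype.card (CounterState β E) ≤ (2 ^ β + 1) * (E + 1) := by
  simpa using Fintype.card_le_of_surjective _ (CounterState.ofFloat_surjective β E)

theorem isFloat_min {β E a : ℕ} (ha : IsFloat β E a) : IsFloat β E (min a (2 ^ (β + E))) := by
  rcases le_total a (2 ^ (β + E)) with h | h
  · rwa [min_eq_left h]
  · rw [min_eq_right h]; exact Or.inr le_rfl

/-- Adding `w` to a saturating floating-point counter. -/
def CounterState.add {β E : ℕ} (a : CounterState β E) (w : ℕ) (u : Fin (2 ^ E)) :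
    CounterState β E :=
  ⟨min (rnd β E (a + w) u) (2 ^ (β + E)), min_le_right _ _, isFloat_min (isFloat_rnd _ _ _ _)⟩

instance (β E : ℕ) : Zero (CounterState β E) := ⟨⟨0, Nat.zero_le _, isFloat_zero β E⟩⟩

theorem coe_foldl_add {β E L : ℕ} (w : Fin L → ℕ) (u : Fin L → Fin (2 ^ E)) :
    ((Fin.foldl L (fun a t => a.add (w t) (u t)) 0 : CounterState β E) : ℕ)
      = min (counter β E w u 0) (2 ^ (β + E)) := by
  have h := foldl_min_eq_min_counter β E w u 0
  rw [Nat.zero_min] at h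
  rw [← h]
  suffices ∀ a : CounterState β E,
      ((Fin.foldl L (fun a t => a.add (w t) (u t)) a : CounterState β E) : ℕ)
        = Fin.foldl L (fun a t => min (rnd β E (a + w t) (u t)) (2 ^ (β + E))) a from this 0
  clear h
  induction L with
  | zero => simp
  | succ L ih => intro a; rw [Fin.foldl_succ, Fin.foldl_succ, ih]; rfl

/-! ### From finite state spaces to strings of bits -/

theorem foldl_pi {ι : Type*} {S : ι → Type*} {L : ℕ} (f : ∀ i, S i → Fin L → S i) (a : ∀ i, S i)
    (i : ι) : Fin.foldl L (fun (a : ∀ i, S i) t => fun i => f i (a i) t) a i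
      = Fin.foldl L (f i) (a i) := by
  induction L generalizing a with
  | zero => simp
  | succ L ih =>
    rw [Fin.foldl_succ, Fin.foldl_succ, ih (fun i s t => f i s t.succ)]

/-- The memory only needs an injective encoding, whereas oracle and coins need bijections with bit
strings in order to stay uniform; hence the inequality for `S` and the equalities for `O` and `U`.
-/
theorem exists_algorithm {n M s oL cL : ℕ} {S O U : Type} [Fintype S] [Fintype O] [Fintype U]
    (hS : Fintype.card S ≤ 2 ^ s) (hO : Fintype.card O = 2 ^ oL) (hU : Fintype.card U = 2 ^ cL)
    (init : S) (upd : O → U → S → Update n M → S) (out : O → S → ℝ) :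
    ∃ A : Algorithm n M s, ∀ (L : ℕ) (σ : Fin L → Update n M) (P : ℝ → Prop) [DecidablePred P],
      A.prob {ρ : A.Randomness L | P (A.estimate ρ σ)}
        = 𝔼 o : O, 𝔼 u : Fin L → U,
          (if P (out o (Fin.foldl L (fun st t => upd o (u t) st (σ t)) init))
            then (1 : ℝ) else 0) := by
  classical
  have eO : Bits oL ≃ O := Fintype.equivOfCardEq (by simp [hO])
  have eU : Bits cL ≃ U := Fintype.equivOfCardEq (by simp [hU])
  obtain ⟨enc⟩ : Nonempty (S ↪ Bits s) :=
    Function.Embedding.nonempty_of_card_le (by simpa using hS)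
  have : Nonempty S := ⟨init⟩
  let dec : Bits s → S := Function.invFun enc
  have hdec : ∀ x, dec (enc x) = x := Function.leftInverse_invFun enc.injective
  let A : Algorithm n M s :=
    { oracleLen := oL
      coinLen := cL
      init := enc init
      update := fun o u st x => enc (upd (eO o) (eU u) (dec st) x)
      output := fun o st => out (eO o) (dec st) }
  refine ⟨A, fun L σ P _ => ?_⟩
  have hfin : ∀ ρ : A.Randomness L, A.estimate ρ σ
      = out (eO ρ.1) (Fin.foldl L (fun st t => upd (eO ρ.1) (eU (ρ.2 t)) st (σ t)) init) := by
    intro ρ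
    have : ∀ a : S, A.finalState ρ σ = A.finalState ρ σ ∧
        Fin.foldl L (fun state t => A.update ρ.1 (ρ.2 t) state (σ t)) (enc a)
          = enc (Fin.foldl L (fun st t => upd (eO ρ.1) (eU (ρ.2 t)) st (σ t)) a) := by
      intro a
      refine ⟨rfl, ?_⟩
      obtain ⟨o, c⟩ := ρ
      clear * - hdec
      induction L generalizing a with
      | zero => simp
      | succ L ih =>
        rw [Fin.foldl_succ, Fin.foldl_succ, ← ih (fun t => σ t.succ) _ (fun t => c t.succ)]
        simp only [A, hdec]
    have h := (this init).2
    change out (eO ρ.1) (dec (Fin.foldl L _ (enc init))) = _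
    rw [h, hdec]
  let e : A.Randomness L ≃ O × (Fin L → U) := eO.prodCongr (Equiv.piCongrRight fun _ => eU)
  rw [← Finset.expect_product', Finset.univ_product_univ,
    ← Fintype.expect_equiv e
      (fun ρ => if P (A.estimate ρ σ) then (1 : ℝ) else 0) _ (fun ρ => by rw [hfin]; rfl),
    Fintype.expect_eq_sum_div_card, Algorithm.prob, Finset.sum_boole, Nat.card_eq_fintype_card,
    Nat.card_eq_fintype_card, Fintype.card_subtype]
  rfl

/-! ### The Laplace transform of the discretized Pareto distribution -/

/-- The Laplace transform of `⌊R / r⌋` for `r` uniform in `{1, …, R}`. -/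
noncomputable def paretoLaplace (R : ℕ) (z : ℝ) : ℝ :=
  𝔼 r : Fin R, Real.exp (-(z * ((R / ((r : ℕ) + 1) : ℕ) : ℝ)))

/-- Summation by parts: each power is one minus a multiple of a geometric sum. After exchanging the
sums, `⌊R / (r + 1)⌋ > j` holds for exactly `⌊R / (j + 1)⌋` values of `r`. -/
theorem sum_pow_div (R : ℕ) (s : ℝ) :
    ∑ r ∈ range R, s ^ (R / (r + 1))
      = R - (1 - s) * ∑ j ∈ range R, s ^ j * (R / (j + 1) : ℕ) := by
  have h1 : ∀ r ∈ range R, s ^ (R / (r + 1))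
      = 1 - (1 - s) * ∑ j ∈ range R, if j < R / (r + 1) then s ^ j else 0 := by
    intro r _
    have : (range R).filter (fun j => j < R / (r + 1)) = range (R / (r + 1)) := by
      ext j
      have := Nat.div_le_self R (r + 1)
      simp only [mem_filter, mem_range]
      omega
    rw [← sum_filter, this, mul_neg_geom_sum]
    ring
  rw [sum_congr rfl h1, sum_sub_distrib, ← mul_sum, sum_comm]
  simp only [sum_const, card_range, nsmul_eq_mul, mul_one]
  congr 2
  refine sum_congr rfl fun j _ => ?_
  have : (range R).filter (fun r => j < R / (r + 1)) = range (R / (j + 1)) := by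
    ext r
    have h2 := Nat.div_le_self R (j + 1)
    simp only [mem_filter, mem_range]
    have h3 : j < R / (r + 1) ↔ (j + 1) * (r + 1) ≤ R := by
      rw [← Nat.succ_le_iff, Nat.le_div_iff_mul_le (by omega)]
    have h4 : r < R / (j + 1) ↔ (r + 1) * (j + 1) ≤ R := by
      rw [← Nat.succ_le_iff, Nat.le_div_iff_mul_le (by omega)]
    rw [h3, h4, mul_comm]
    exact ⟨fun h => h.2, fun h => ⟨by nlinarith, h⟩⟩
  rw [← sum_filter, this, sum_const, card_range, nsmul_eq_mul, mul_comm]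

theorem paretoLaplace_eq {R : ℕ} (hR : 0 < R) (z : ℝ) :
    paretoLaplace R z = 1 - (1 - Real.exp (-z))
      * ∑ j ∈ range R, Real.exp (-z) ^ j * ((R / (j + 1) : ℕ) / R : ℝ) := by
  have h := sum_pow_div R (Real.exp (-z))
  have hR' : (R : ℝ) ≠ 0 := by positivity
  rw [paretoLaplace, Fintype.expect_eq_sum_div_card, Fintype.card_fin]
  have h1 : ∑ r : Fin R, Real.exp (-(z * ((R / ((r : ℕ) + 1) : ℕ) : ℝ)))
      = ∑ r ∈ range R, Real.exp (-z) ^ (R / (r + 1)) := by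
    rw [Finset.sum_range]
    refine sum_congr rfl fun r _ => ?_
    rw [← Real.exp_nat_mul]
    congr 1; ring
  rw [h1, h, sub_div, div_self hR', mul_div_assoc, sum_div]
  simp only [mul_div_assoc]

/-- Without the floors, the tail probabilities are `1 / (j + 1)` and the series is that of `-log (1
- s) / s`. Each floor costs at most `1 / R`, and the resulting geometric series is cancelled by the
prefactor `1 - s`. -/
theorem abs_paretoLaplace_sub_le {R : ℕ} (hR : 0 < R) {z : ℝ} (hz : 0 < z) :
    |paretoLaplace R z - (1 + (Real.exp z - 1) * Real.log (1 - Real.exp (-z)))| ≤ 1 / R := by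
  have hR' : (0 : ℝ) < R := by positivity
  rw [paretoLaplace_eq hR]
  set s := Real.exp (-z) with hs
  have hs0 : 0 < s := Real.exp_pos _
  have hs1 : s < 1 := by rw [hs, Real.exp_lt_one_iff]; linarith
  have hez : Real.exp z = s⁻¹ := by rw [hs, Real.exp_neg, inv_inv]
  have h1 : HasSum (fun j : ℕ => s ^ j * (1 / ((j : ℝ) + 1))) (-Real.log (1 - s) / s) := by
    have := (Real.hasSum_pow_div_log_of_abs_lt_one (x := s)
      (by rw [abs_of_pos hs0]; exact hs1)).div_const s
    refine this.congr_fun ?_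
    intro j
    rw [pow_succ]
    field_simp
  have h2 : HasSum (fun j : ℕ => s ^ j * ((R / (j + 1) : ℕ) / R : ℝ))
      (∑ j ∈ range R, s ^ j * ((R / (j + 1) : ℕ) / R : ℝ)) := by
    refine hasSum_sum_of_ne_finset_zero fun j hj => ?_
    have : R / (j + 1) = 0 := Nat.div_eq_of_lt (by simp at hj; omega)
    simp [this]
  have h3 := h1.sub h2
  have h4 : HasSum (fun j : ℕ => s ^ j * (1 / R)) ((1 - s)⁻¹ * (1 / R)) :=
    (hasSum_geometric_of_lt_one hs0.le hs1).mul_right _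
  set D := -Real.log (1 - s) / s - ∑ j ∈ range R, s ^ j * ((R / (j + 1) : ℕ) / R : ℝ) with hD
  have hfl : ∀ j : ℕ, ((R / (j + 1) : ℕ) / R : ℝ) ≤ 1 / ((j : ℝ) + 1) ∧
      1 / ((j : ℝ) + 1) ≤ ((R / (j + 1) : ℕ) / R : ℝ) + 1 / R := by
    intro j
    have a1 : ((R / (j + 1) : ℕ) * ((j : ℝ) + 1)) ≤ R := by
      exact_mod_cast Nat.div_mul_le_self R (j + 1)
    have a2 : (R : ℝ) ≤ ((R / (j + 1) : ℕ) + 1) * ((j : ℝ) + 1) := by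
      have := (Nat.lt_mul_div_succ R (Nat.succ_pos j)).le
      rw [mul_comm] at this
      exact_mod_cast this
    constructor
    · rw [div_le_div_iff₀ hR' (by positivity)]; linarith
    · rw [← add_div, div_le_div_iff₀ (by positivity) hR']; linarith
  have hD0 : 0 ≤ D := h3.nonneg fun j => by
    have := mul_le_mul_of_nonneg_left (hfl j).1 (pow_nonneg hs0.le j)
    linarith
  have hD1 : D ≤ (1 - s)⁻¹ * (1 / R) := hasSum_le (fun j => by
    have := mul_le_mul_of_nonneg_left (hfl j).2 (pow_nonneg hs0.le j)
    linarith) h3 h4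
  have hs1' : 0 < 1 - s := by linarith
  have heq : 1 - (1 - s) * ∑ j ∈ range R, s ^ j * ((R / (j + 1) : ℕ) / R : ℝ)
      - (1 + (Real.exp z - 1) * Real.log (1 - s)) = (1 - s) * D := by
    rw [hD, hez]; field_simp; ring
  rw [heq, abs_of_nonneg (by positivity)]
  calc (1 - s) * D ≤ (1 - s) * ((1 - s)⁻¹ * (1 / R)) := by gcongr
    _ = 1 / R := by field_simp

theorem abs_exp_sub_one_mul_log_sub_le {z : ℝ} (hz : 0 < z) (hz1 : z ≤ 1 / 2) :
    |(Real.exp z - 1) * Real.log (1 - Real.exp (-z)) - z * Real.log z|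
      ≤ z ^ 2 * (|Real.log z| + 3) := by
  have h1 : |Real.exp z - 1 - z| ≤ z ^ 2 :=
    Real.abs_exp_sub_one_sub_id_le (by rw [abs_of_pos hz]; linarith)
  have h2 : |Real.exp (-z) - 1 - -z| ≤ (-z) ^ 2 :=
    Real.abs_exp_sub_one_sub_id_le (by rw [abs_neg, abs_of_pos hz]; linarith)
  have h3 : -z + 1 ≤ Real.exp (-z) := Real.add_one_le_exp _
  have h4 := abs_le.1 h1
  have h5 := abs_le.1 h2
  set E := 1 - Real.exp (-z) with hE
  have hEz : E ≤ z := by linarith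
  have hEl : z * (1 - z) ≤ E := by nlinarith
  have hE0 : 0 < E := lt_of_lt_of_le (mul_pos hz (by linarith)) hEl
  have hlog : |Real.log E - Real.log z| ≤ 2 * z := by
    have hle : Real.log E ≤ Real.log z := Real.log_le_log hE0 hEz
    rw [abs_of_nonpos (by linarith)]
    have h6 : Real.log (z * (1 - z)) ≤ Real.log E :=
      Real.log_le_log (mul_pos hz (by linarith)) hEl
    rw [Real.log_mul hz.ne' (by linarith)] at h6
    have h7 := Real.one_sub_inv_le_log_of_pos (x := 1 - z) (by linarith)
    have h8 : (1 - z)⁻¹ ≤ 1 + 2 * z := by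
      rw [inv_le_iff_one_le_mul₀ (by linarith)]
      nlinarith
    linarith
  have heq : (Real.exp z - 1) * Real.log E - z * Real.log z
      = (Real.exp z - 1 - z) * Real.log z + (Real.exp z - 1) * (Real.log E - Real.log z) := by
    ring
  have h9 : |Real.exp z - 1| ≤ 3 / 2 * z := by
    rw [abs_of_nonneg (by linarith [Real.add_one_le_exp z])]
    nlinarith
  rw [heq]
  calc _ ≤ |(Real.exp z - 1 - z) * Real.log z|
        + |(Real.exp z - 1) * (Real.log E - Real.log z)| := abs_add_le _ _
    _ ≤ z ^ 2 * |Real.log z| + 3 / 2 * z * (2 * z) := by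
        rw [abs_mul, abs_mul]; gcongr
    _ = _ := by ring

theorem abs_log_one_add_sub_le {x : ℝ} (hx : |x| ≤ 1 / 2) : |Real.log (1 + x) - x| ≤ 2 * x ^ 2 := by
  have h := abs_le.1 hx
  have h1 := Real.log_le_sub_one_of_pos (x := 1 + x) (by linarith)
  have h2 := Real.one_sub_inv_le_log_of_pos (x := 1 + x) (by linarith)
  have h3 : (1 + x)⁻¹ ≤ 1 - x + 2 * x ^ 2 := by
    rw [inv_le_iff_one_le_mul₀ (by linarith)]
    nlinarith [sq_nonneg x]
  rw [abs_le]
  constructor <;> nlinarith [sq_nonneg x]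

/-- The transform is `1 + x` with `x ≈ z log z`. The quadratic error of the logarithm is of order
`(z log z)²`, which `z Λ² ≤ τ` bounds by a multiple of `τ z`. An error proportional to `z` is what
can be summed over the coordinates. -/
theorem abs_log_paretoLaplace_sub_le {R : ℕ} (hR : 0 < R) {z Λ τ : ℝ} (hz : 0 < z)
    (hΛ : |Real.log z| ≤ Λ) (hΛ3 : 3 ≤ Λ) (hτ : τ ≤ 1 / 8) (hzΛ : z * Λ ^ 2 ≤ τ)
    (hRτ : 1 / R ≤ τ * z) :
    0 < paretoLaplace R z ∧ |Real.log (paretoLaplace R z) - z * Real.log z| ≤ 10 * τ * z := by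
  have hz9 : z * 9 ≤ τ := le_trans (by gcongr; nlinarith) hzΛ
  have hτ0 : 0 < τ := by linarith
  have h1 := abs_paretoLaplace_sub_le hR hz
  have h2 := abs_exp_sub_one_mul_log_sub_le hz (by linarith)
  obtain ⟨x, hx⟩ : ∃ x, paretoLaplace R z = 1 + x := ⟨paretoLaplace R z - 1, by ring⟩
  rw [hx] at h1 ⊢
  have h3 : |x - z * Real.log z| ≤ 2 * τ * z := by
    have a : z ^ 2 * (|Real.log z| + 3) ≤ τ * z := by
      have : z ^ 2 * (|Real.log z| + 3) ≤ z * (z * Λ ^ 2) := by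
        have : |Real.log z| + 3 ≤ Λ ^ 2 := by nlinarith
        calc _ ≤ z ^ 2 * Λ ^ 2 := by gcongr
          _ = _ := by ring
      nlinarith
    have b := abs_add_le (1 + x - (1 + (Real.exp z - 1) * Real.log (1 - Real.exp (-z))))
      ((Real.exp z - 1) * Real.log (1 - Real.exp (-z)) - z * Real.log z)
    have c : 1 + x - (1 + (Real.exp z - 1) * Real.log (1 - Real.exp (-z)))
      + ((Real.exp z - 1) * Real.log (1 - Real.exp (-z)) - z * Real.log z)
      = x - z * Real.log z := by ring
    rw [c] at b
    linarith
  have h4 : |x| ≤ 2 * (z * Λ) := by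
    have b := abs_add_le (x - z * Real.log z) (z * Real.log z)
    rw [sub_add_cancel, abs_mul, abs_of_pos hz] at b
    have : z * |Real.log z| ≤ z * Λ := by gcongr
    nlinarith
  have h5 : x ^ 2 ≤ 4 * τ * z := by
    rw [← sq_abs]
    calc |x| ^ 2 ≤ (2 * (z * Λ)) ^ 2 := by gcongr
      _ = 4 * z * (z * Λ ^ 2) := by ring
      _ ≤ 4 * z * τ := by gcongr
      _ = _ := by ring
  have h6 : |x| ≤ 1 / 2 := by
    refine abs_le_of_sq_le_sq ?_ (by norm_num)
    nlinarith
  have h7 := abs_log_one_add_sub_le h6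
  refine ⟨by linarith [(abs_le.1 h6).1], ?_⟩
  have b := abs_add_le (Real.log (1 + x) - x) (x - z * Real.log z)
  rw [sub_add_sub_cancel] at b
  linarith

/-! ### Independent samples -/

theorem expect_prod_apply {ι α : Type*} [Fintype ι] [DecidableEq ι] [Fintype α]
    (f : ι → α → ℝ) : 𝔼 ω : ι → α, ∏ i, f i (ω i) = ∏ i, 𝔼 a, f i a := by
  simp_rw [Fintype.expect_eq_sum_div_card]
  rw [Finset.prod_div_distrib, Finset.prod_univ_sum, Fintype.piFinset_univ]
  simp

theorem expect_sum_apply_sq {Ω : Type*} [Fintype Ω] [Nonempty Ω] (g : Ω → ℝ)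
    (hg : 𝔼 ω, g ω = 0) (k : ℕ) :
    𝔼 o : Fin k → Ω, ∑ j, g (o j) = 0 ∧
      𝔼 o : Fin k → Ω, (∑ j, g (o j)) ^ 2 = k * 𝔼 ω, g ω ^ 2 := by
  induction k with
  | zero => simp
  | succ k ih =>
    constructor
    · rw [expect_finCons]
      simp_rw [Fin.sum_univ_succ, Fin.cons_zero, Fin.cons_succ, Finset.expect_add_distrib, ih.1,
        Fintype.expect_const, hg, add_zero]
    · rw [expect_finCons]
      have : ∀ (x : Ω) (u : Fin k → Ω),
          (∑ j, g ((Fin.cons x u : Fin (k + 1) → Ω) j)) ^ 2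
            = g x ^ 2 + 2 * g x * (∑ j, g (u j)) + (∑ j, g (u j)) ^ 2 := by
        intro x u
        rw [Fin.sum_univ_succ, Fin.cons_zero]
        simp_rw [Fin.cons_succ]
        ring
      simp_rw [this, Finset.expect_add_distrib, ← Finset.mul_expect, ih.1, ih.2,
        Fintype.expect_const, mul_zero, Finset.expect_const_zero]
      push_cast; ring

theorem expect_average_bad_le {Ω : Type*} [Fintype Ω] [Nonempty Ω] (f : Ω → ℝ) {k : ℕ}
    (hk : 0 < k) {t V : ℝ} (ht : 0 < t) (hV : 𝔼 ω, f ω ^ 2 ≤ V) :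
    𝔼 o : Fin k → Ω, (if t < |(∑ j, f (o j)) / k - 𝔼 ω, f ω| then (1 : ℝ) else 0)
      ≤ V / (k * t ^ 2) := by
  set e := 𝔼 ω, f ω with he
  have hk' : (0 : ℝ) < k := by positivity
  have hg : 𝔼 ω, (f ω - e) = 0 := by
    rw [Finset.expect_sub_distrib, Fintype.expect_const, ← he, sub_self]
  have hg2 : 𝔼 ω, (f ω - e) ^ 2 ≤ V := by
    have : ∀ ω, (f ω - e) ^ 2 = f ω ^ 2 + (-2 * e) * f ω + e ^ 2 := by intro ω; ring
    simp_rw [this]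
    rw [Finset.expect_add_distrib, Finset.expect_add_distrib, Fintype.expect_const,
      ← Finset.mul_expect, ← he]
    nlinarith [sq_nonneg e]
  refine (expect_ite_lt_abs_le (v := V / k) _ ht ?_).trans (le_of_eq (by field_simp))
  have h1 : ∀ o : Fin k → Ω, ((∑ j, f (o j)) / k - e) ^ 2
      = (∑ j, (f (o j) - e)) ^ 2 * (1 / (k : ℝ) ^ 2) := by
    intro o
    rw [sum_sub_distrib, sum_const, card_univ, Fintype.card_fin, nsmul_eq_mul]
    field_simp
  simp_rw [h1]
  rw [← Finset.expect_mul, (expect_sum_apply_sq _ hg k).2]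
  calc (k : ℝ) * (𝔼 ω, (f ω - e) ^ 2) * (1 / (k : ℝ) ^ 2)
      ≤ (k : ℝ) * V * (1 / (k : ℝ) ^ 2) := by gcongr
    _ = V / k := by field_simp

/-! ### The linear sketch and the entropy -/

/-- The weight of coordinate `i` in the linear sketch with randomness `ω`. -/
def sketchWeight {n N R : ℕ} (ω : Fin n → Fin N → Fin R) (i : Fin n) : ℕ :=
  ∑ l, R / ((ω i l : ℕ) + 1)

/-- The linear sketch of the vector `x` with randomness `ω`. -/
def sketch {n N R : ℕ} (x : Fin n → ℕ) (ω : Fin n → Fin N → Fin R) : ℕ :=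
  ∑ i, x i * sketchWeight ω i

theorem expect_exp_neg_sketch {n N R : ℕ} (x : Fin n → ℕ) (b : ℝ) :
    𝔼 ω : Fin n → Fin N → Fin R, Real.exp (-(b * sketch x ω))
      = ∏ i, paretoLaplace R (b * x i) ^ N := by
  have h1 : ∀ i, paretoLaplace R (b * x i) ^ N
      = 𝔼 ω : Fin N → Fin R, ∏ l, Real.exp (-(b * x i * ((R / ((ω l : ℕ) + 1) : ℕ) : ℝ))) := by
    intro i
    rw [expect_prod_apply (fun _ (r : Fin R) =>
      Real.exp (-(b * x i * ((R / ((r : ℕ) + 1) : ℕ) : ℝ)))), prod_const, card_univ,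
      Fintype.card_fin, paretoLaplace]
  simp_rw [h1]
  rw [← expect_prod_apply (fun i (ω : Fin N → Fin R) =>
    ∏ l, Real.exp (-(b * x i * ((R / ((ω l : ℕ) + 1) : ℕ) : ℝ))))]
  refine Finset.expect_congr rfl fun ω _ => ?_
  simp_rw [← Real.exp_sum]
  congr 1
  simp only [sketch, sketchWeight, sum_neg_distrib, mul_sum, Nat.cast_sum, Nat.cast_mul]
  congr 1
  exact sum_congr rfl fun i _ => sum_congr rfl fun l _ => by ring

theorem l1_pos {n : ℕ} {x : Fin n → ℕ} (hx : x ≠ 0) : 0 < l1 x := by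
  obtain ⟨i, hi⟩ := Function.ne_iff.1 hx
  exact lt_of_lt_of_le (Nat.pos_of_ne_zero hi) (single_le_sum (f := x) (fun _ _ => Nat.zero_le _)
    (mem_univ i))

theorem le_l1 {n : ℕ} (x : Fin n → ℕ) (i : Fin n) : x i ≤ l1 x :=
  single_le_sum (f := x) (fun _ _ => Nat.zero_le _) (mem_univ i)

theorem sum_div_l1 {n : ℕ} {x : Fin n → ℕ} (hx : x ≠ 0) : ∑ i, (x i : ℝ) / l1 x = 1 := by
  have := l1_pos hx
  rw [← sum_div, l1, Nat.cast_sum, div_self]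
  have h : (0 : ℝ) < (l1 x : ℕ) := by exact_mod_cast this
  simpa [l1] using h.ne'

/-- By independence the logarithm of the expectation is a sum of `N z log z` terms. Since the `pᵢ`
sum to `1`, the terms linear in `pᵢ` collapse, `∑ pᵢ log pᵢ` leaves `-H`, and the errors add up to
at most `τ a`. -/
theorem expect_exp_neg_sketch_eq {n N R : ℕ} {x : Fin n → ℕ} (hx : x ≠ 0) (hN : 0 < N)
    (hR : 0 < R) {a τ : ℝ} (ha : 0 < a)
    (h : ∀ i, x i ≠ 0 → 0 < paretoLaplace R (a / (N * l1 x) * x i) ∧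
      |Real.log (paretoLaplace R (a / (N * l1 x) * x i))
        - a / (N * l1 x) * x i * Real.log (a / (N * l1 x) * x i)| ≤ τ * (a / (N * l1 x) * x i)) :
    ∃ r : ℝ, |r| ≤ τ * a ∧
      𝔼 ω : Fin n → Fin N → Fin R, Real.exp (-(a / (N * l1 x) * sketch x ω))
        = Real.exp (a * (Real.log a - entropy x - Real.log N) + r) := by
  have hF : (0 : ℝ) < l1 x := by exact_mod_cast l1_pos hx
  have hN' : (0 : ℝ) < N := by exact_mod_cast hN
  have hsum := sum_div_l1 hx
  set z : Fin n → ℝ := fun i => a / (N * l1 x) * x i with hz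
  have hφ0 : paretoLaplace R 0 = 1 := by
    have : Nonempty (Fin R) := ⟨⟨0, hR⟩⟩
    simp [paretoLaplace]
  have hpos : ∀ i, 0 < paretoLaplace R (z i) ∧
      |Real.log (paretoLaplace R (z i)) - z i * Real.log (z i)| ≤ τ * z i := by
    intro i
    -- A zero coordinate gives `z i = 0`, where the transform is `1` and `0 * log 0 = 0`.
    by_cases hi : x i = 0
    · have : z i = 0 := by simp [hz, hi]
      rw [this, hφ0]; simp
    · exact h i hi
  have hlin : ∀ i, N * (z i * Real.log (z i))
      = a * (Real.log a - Real.log N) * (x i / l1 x)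
        - a * ((x i : ℝ) / l1 x * Real.log (l1 x / x i)) := by
    intro i
    by_cases hi : x i = 0
    · simp [hz, hi]
    · have hxi : (0 : ℝ) < x i := by exact_mod_cast Nat.pos_of_ne_zero hi
      have e1 : Real.log (z i)
          = Real.log a - Real.log N - Real.log (l1 x / x i) := by
        rw [hz]
        simp only
        rw [Real.log_mul (by positivity) hxi.ne', Real.log_div ha.ne' (by positivity),
          Real.log_mul hN'.ne' hF.ne', Real.log_div hF.ne' hxi.ne']
        ring
      rw [e1]
      simp only [hz]
      field_simp
  have hlin' : ∑ i, N * (z i * Real.log (z i))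
      = a * (Real.log a - entropy x - Real.log N) := by
    rw [sum_congr rfl fun i _ => hlin i, sum_sub_distrib, ← mul_sum, ← mul_sum, hsum, entropy]
    ring
  refine ⟨∑ i, N * (Real.log (paretoLaplace R (z i)) - z i * Real.log (z i)), ?_, ?_⟩
  · calc _ ≤ ∑ i, |N * (Real.log (paretoLaplace R (z i)) - z i * Real.log (z i))| :=
          abs_sum_le_sum_abs _ _
      _ ≤ ∑ i, N * (τ * z i) := by
          refine sum_le_sum fun i _ => ?_
          rw [abs_mul, abs_of_pos hN']
          exact mul_le_mul_of_nonneg_left (hpos i).2 hN'.le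
      _ = ∑ i, τ * a * ((x i : ℝ) / l1 x) := by
          refine sum_congr rfl fun i _ => ?_
          simp only [hz]
          field_simp
      _ = τ * a := by rw [← mul_sum, hsum, mul_one]
  · rw [expect_exp_neg_sketch, ← hlin', ← sum_add_distrib, Real.exp_sum]
    refine prod_congr rfl fun i _ => ?_
    rw [← mul_add, add_sub_cancel, Real.exp_nat_mul, Real.exp_log (hpos i).1]

theorem entropy_le_log {n : ℕ} {x : Fin n → ℕ} (hx : x ≠ 0) : entropy x ≤ Real.log (l1 x) := by
  have hF : (0 : ℝ) < l1 x := by exact_mod_cast l1_pos hx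
  calc entropy x ≤ ∑ i, (x i : ℝ) / l1 x * Real.log (l1 x) := by
        refine sum_le_sum fun i _ => ?_
        by_cases hi : x i = 0
        · simp [hi]
        · have hxi : (1 : ℝ) ≤ x i := by exact_mod_cast Nat.pos_of_ne_zero hi
          gcongr
          exact div_le_self hF.le hxi
    _ = Real.log (l1 x) := by rw [← sum_mul, sum_div_l1 hx, one_mul]

/-! ### Stability of the estimator under relative errors -/

theorem abs_div_sub_div_le {S S' F F' η : ℝ} (hS : 0 ≤ S) (hF : 0 < F) (hη : 0 ≤ η)
    (hη2 : η ≤ 1 / 2) (h1 : |S' - S| ≤ η * S) (h2 : |F' - F| ≤ η * F) :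
    |S' / F' - S / F| ≤ 4 * η * (S / F) := by
  have a1 := abs_le.1 h1
  have a2 := abs_le.1 h2
  have hF' : 0 < F' := by nlinarith
  have hηS : 0 ≤ η * S := by positivity
  have hηF : 0 ≤ η * F := by positivity
  have e : 4 * η * (S / F) = 4 * η * S / F := by ring
  rw [abs_le, e]
  constructor
  · rw [neg_le_sub_iff_le_add, ← sub_le_iff_le_add, ← sub_div, div_le_div_iff₀ hF hF']
    have : 0 ≤ S * F := by positivity
    rcases le_or_gt (1 - 4 * η) 0 with h | h
    · have : S - 4 * η * S ≤ 0 := by nlinarith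
      nlinarith [mul_nonneg (show 0 ≤ S' by nlinarith) hF.le]
    · calc (S - 4 * η * S) * F' = (1 - 4 * η) * S * F' := by ring
        _ ≤ (1 - 4 * η) * S * ((1 + η) * F) := by gcongr; linarith
        _ ≤ (1 - η) * S * F := by
          nlinarith [mul_nonneg (mul_nonneg hη hη) this, mul_nonneg hη this]
        _ ≤ S' * F := by gcongr; linarith
  · rw [sub_le_iff_le_add, ← add_div, div_le_div_iff₀ hF' hF]
    have : 0 ≤ S * F := by positivity
    calc S' * F ≤ (1 + η) * S * F := by gcongr; linarith
      _ ≤ (1 + 4 * η) * S * ((1 - η) * F) := by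
        nlinarith [mul_nonneg (mul_nonneg hη (sub_nonneg.2 hη2)) this]
      _ ≤ (1 + 4 * η) * S * F' := by gcongr; linarith
      _ = (4 * η * S + S) * F' := by ring

/-- Up to the threshold `T`, the relative error `κ` in `Y` is an additive error at most `e`, hence a
relative error `2 e` of the exponential. Beyond `T`, both exponentials are at most `exp (-T / 2)`,
which is negligible against `μ`. -/
theorem abs_exp_neg_sub_exp_neg_le {Y Y' κ T e μ : ℝ} (hY : 0 ≤ Y) (hκ : κ ≤ 1 / 2)
    (h : |Y' - Y| ≤ κ * Y) (hT : κ * T ≤ e) (hκ0 : 0 ≤ κ) (he : 0 ≤ e)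
    (he1 : e ≤ 1) (hμ : Real.exp (-(T / 2)) ≤ e * μ) :
    |Real.exp (-Y') - Real.exp (-Y)| ≤ 2 * e * Real.exp (-Y) + e * μ := by
  have hpos : 0 < e * μ := lt_of_lt_of_le (Real.exp_pos _) hμ
  rcases le_total Y T with hYT | hYT
  · have h1 : |Y - Y'| ≤ e := by
      rw [abs_sub_comm]
      exact h.trans (le_trans (by gcongr) hT)
    have h2 : Real.exp (-Y') = Real.exp (-Y) * Real.exp (Y - Y') := by
      rw [← Real.exp_add]; congr 1; ring
    have h3 := Real.abs_exp_sub_one_le (h1.trans he1)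
    have h4 : |Real.exp (-Y') - Real.exp (-Y)| = Real.exp (-Y) * |Real.exp (Y - Y') - 1| := by
      rw [h2, ← abs_of_pos (Real.exp_pos (-Y)), ← abs_mul, abs_of_pos (Real.exp_pos (-Y))]
      congr 1; ring
    rw [h4]
    have h5 : Real.exp (-Y) * |Real.exp (Y - Y') - 1| ≤ Real.exp (-Y) * (2 * e) := by
      gcongr; linarith
    linarith
  · have h1 := abs_le.1 h
    have h2 : Real.exp (-Y') ≤ Real.exp (-(T / 2)) := Real.exp_le_exp.2 (by nlinarith)
    have h3 : Real.exp (-Y) ≤ Real.exp (-(T / 2)) := Real.exp_le_exp.2 (by linarith)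
    have h5 := Real.exp_pos (-Y)
    have h6 := Real.exp_pos (-Y')
    have h7 : 0 ≤ 2 * e * Real.exp (-Y) := by positivity
    rw [abs_le]
    constructor <;> linarith

theorem abs_log_average_sub_le {k : ℕ} (hk : 0 < k) {Y Y' : Fin k → ℝ} {κ T e μ : ℝ}
    (hY : ∀ j, 0 ≤ Y j) (hκ0 : 0 ≤ κ) (hκ : κ ≤ 1 / 2) (h : ∀ j, |Y' j - Y j| ≤ κ * Y j)
    (hT : κ * T ≤ e) (he0 : 0 < e) (he1 : e ≤ 1 / 32) (hμ0 : 0 < μ)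
    (hμ : Real.exp (-(T / 2)) ≤ e * μ)
    (havg : |(∑ j, Real.exp (-Y j)) / k - μ| ≤ 3 * e * μ) :
    |Real.log ((∑ j, Real.exp (-Y' j)) / k) - Real.log μ| ≤ 16 * e := by
  have hk' : (0 : ℝ) < k := by exact_mod_cast hk
  set Z := (∑ j, Real.exp (-Y j)) / k with hZ
  set Z' := (∑ j, Real.exp (-Y' j)) / k with hZ'
  have h1 : |Z' - Z| ≤ 2 * e * Z + e * μ := by
    rw [hZ, hZ', ← sub_div, abs_div, abs_of_pos hk', div_le_iff₀ hk', ← sum_sub_distrib]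
    calc _ ≤ ∑ j, |Real.exp (-Y' j) - Real.exp (-Y j)| := abs_sum_le_sum_abs _ _
      _ ≤ ∑ j, (2 * e * Real.exp (-Y j) + e * μ) := sum_le_sum fun j _ =>
          abs_exp_neg_sub_exp_neg_le (hY j) hκ (h j) hT hκ0 he0.le (by linarith) hμ
      _ = _ := by
        rw [sum_add_distrib, ← mul_sum, sum_const, card_univ, Fintype.card_fin, nsmul_eq_mul]
        field_simp
  have h2 := abs_le.1 h1
  have h3 := abs_le.1 havg
  have heμ : 0 < e * μ := by positivity
  have hZle : Z ≤ (1 + 3 / 32) * μ := by nlinarith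
  have heZ : e * Z ≤ (1 + 3 / 32) * (e * μ) := by nlinarith
  obtain ⟨x, hx⟩ : ∃ x, Z' = μ * (1 + x) := ⟨Z' / μ - 1, by field_simp; ring⟩
  have hxe : |x| ≤ 7 * e := by
    have h4 : |μ * x| ≤ 7 * e * μ := by
      have : μ * x = Z' - μ := by rw [hx]; ring
      rw [this, abs_le]
      constructor <;> linarith
    rw [abs_mul, abs_of_pos hμ0, mul_comm] at h4
    exact le_of_mul_le_mul_right h4 hμ0
  have hx2 : |x| ≤ 1 / 2 := by linarith
  have h5 := abs_log_one_add_sub_le hx2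
  have h6 : 0 < 1 + x := by linarith [(abs_le.1 hx2).1]
  rw [hx, Real.log_mul hμ0.ne' h6.ne', add_sub_cancel_left]
  have h7 : x ^ 2 ≤ |x| * (1 / 2) := by
    rw [← sq_abs, sq]; gcongr
  have h8 := abs_add_le (Real.log (1 + x) - x) x
  rw [sub_add_cancel] at h8
  linarith

/-! ### The streaming algorithm and its parameters -/

theorem sum_mul_freq {n M L : ℕ} (σ : Fin L → Update n M) (f : Fin n → ℕ) :
    ∑ i, freq σ i * f i = ∑ t, ((σ t).2 : ℕ) * f (σ t).1 := by
  simp_rw [freq, sum_mul]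
  rw [sum_comm]
  refine sum_congr rfl fun t _ => ?_
  simp [ite_mul]

theorem l1_freq {n M L : ℕ} (σ : Fin L → Update n M) : l1 (freq σ) = ∑ t, ((σ t).2 : ℕ) := by
  simpa [l1] using sum_mul_freq σ (fun _ => 1)

theorem l1_freq_le {n M L : ℕ} (σ : Fin L → Update n M) : l1 (freq σ) ≤ L * M := by
  rw [l1_freq]
  calc _ ≤ ∑ _t : Fin L, M := sum_le_sum fun t _ => by omega
    _ = L * M := by simp

theorem sketch_le {n N R : ℕ} (x : Fin n → ℕ) (ω : Fin n → Fin N → Fin R) :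
    sketch x ω ≤ l1 x * (N * R) := by
  rw [sketch, l1, sum_mul]
  refine sum_le_sum fun i _ => Nat.mul_le_mul_left _ ?_
  calc sketchWeight ω i ≤ ∑ _l : Fin N, R := sum_le_sum fun l _ => Nat.div_le_self _ _
    _ = N * R := by simp

theorem sketch_pos {n N R : ℕ} {x : Fin n → ℕ} (hx : x ≠ 0) (hN : 0 < N)
    (ω : Fin n → Fin N → Fin R) : 0 < sketch x ω := by
  refine lt_of_lt_of_le (l1_pos hx) (sum_le_sum fun i _ => Nat.le_mul_of_pos_right _ ?_)
  refine sum_pos (fun l _ => Nat.div_pos (by omega) (by omega)) ⟨⟨0, hN⟩, mem_univ _⟩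

theorem le_two_pow_self (w : ℕ) : (w : ℝ) ≤ 2 ^ w := by
  exact_mod_cast Nat.lt_two_pow_self.le

/-- With `x = 2 ^ w`, the choice `N = x ^ 4` puts every argument `z` between `x ^ (-5)` and `2 x ^
(-4)`, small enough for the asymptotics. The choice `R = x ^ 7` makes `1 / R` negligible even
against the smallest `z`. -/
theorem paretoLaplace_estimate {g w F y : ℕ} (hw : g + 9 ≤ w) (hF : F ≤ 2 ^ w) (hy : y ≠ 0)
    (hyF : y ≤ F) {a : ℝ} (ha1 : 1 ≤ a) (ha2 : a ≤ 2) :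
    0 < paretoLaplace (2 ^ (7 * w)) (a / ((2 ^ (4 * w) : ℕ) * F) * y) ∧
      |Real.log (paretoLaplace (2 ^ (7 * w)) (a / ((2 ^ (4 * w) : ℕ) * F) * y))
        - a / ((2 ^ (4 * w) : ℕ) * F) * y * Real.log (a / ((2 ^ (4 * w) : ℕ) * F) * y)|
        ≤ (2 ^ g)⁻¹ * (a / ((2 ^ (4 * w) : ℕ) * F) * y) := by
  have hy1 : (1 : ℝ) ≤ y := by exact_mod_cast Nat.pos_of_ne_zero hy
  have hyF' : (y : ℝ) ≤ F := by exact_mod_cast hyF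
  have hF1 : (F : ℝ) ≤ 2 ^ w := by exact_mod_cast hF
  have hF0 : (0 : ℝ) < F := by linarith
  set x : ℝ := 2 ^ w with hx
  set G : ℝ := 2 ^ g with hG
  have hG0 : 0 < G := by positivity
  have hx0 : 0 < x := by positivity
  have hGx : G * 2 ^ 9 ≤ x := by
    rw [hG, hx, ← pow_add]
    exact pow_le_pow_right₀ (by norm_num) hw
  have hG1 : 1 ≤ G := one_le_pow₀ (by norm_num)
  have hwx : (w : ℝ) ≤ x := le_two_pow_self w
  have hN : ((2 ^ (4 * w) : ℕ) : ℝ) = x ^ 4 := by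
    push_cast; rw [hx, ← pow_mul, mul_comm]
  have hR : ((2 ^ (7 * w) : ℕ) : ℝ) = x ^ 7 := by
    push_cast; rw [hx, ← pow_mul, mul_comm]
  rw [hN]
  set z : ℝ := a / (x ^ 4 * F) * y with hz
  have hzl : 1 / x ^ 5 ≤ z := by
    rw [hz, div_mul_eq_mul_div, div_le_div_iff₀ (by positivity) (by positivity)]
    calc 1 * (x ^ 4 * F) ≤ (a * y) * (x ^ 4 * x) := by
          gcongr
          nlinarith
      _ = _ := by ring
  have hzu : z ≤ 2 / x ^ 4 := by
    rw [hz, div_mul_eq_mul_div, div_le_div_iff₀ (by positivity) (by positivity)]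
    calc a * y * x ^ 4 ≤ 2 * F * x ^ 4 := by gcongr
      _ = _ := by ring
  have hz0 : 0 < z := lt_of_lt_of_le (by positivity) hzl
  have hx512 : 512 ≤ x := by nlinarith
  have hw9 : (9 : ℝ) ≤ w := by exact_mod_cast (by omega : 9 ≤ w)
  have hz1 : z ≤ 1 := hzu.trans (by
    rw [div_le_one (by positivity)]
    nlinarith [pow_le_pow_left₀ (by norm_num) hx512 4])
  -- From `z ≥ 2 ^ (-5 w)`, because `5 log 2 < 4`.
  have hlog : |Real.log z| ≤ 4 * w := by
    rw [abs_of_nonpos (Real.log_nonpos hz0.le hz1)]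
    have h1 := Real.log_le_log (by positivity) hzl
    rw [one_div, Real.log_inv, hx, ← pow_mul, Real.log_pow] at h1
    have h2 := Real.log_two_lt_d9
    push_cast at h1
    nlinarith
  have hτ : z * (4 * w) ^ 2 ≤ (16 * G)⁻¹ := by
    calc z * (4 * w) ^ 2 ≤ 2 / x ^ 4 * (4 * x) ^ 2 := by gcongr
      _ = 32 / x ^ 2 := by field_simp; ring
      _ ≤ (16 * G)⁻¹ := by
        rw [div_le_iff₀ (by positivity), inv_mul_eq_div, le_div_iff₀ (by positivity)]
        nlinarith
  have hRτ : 1 / ((2 ^ (7 * w) : ℕ) : ℝ) ≤ (16 * G)⁻¹ * z := by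
    rw [hR]
    calc 1 / x ^ 7 = 1 / x ^ 2 * (1 / x ^ 5) := by field_simp
      _ ≤ (16 * G)⁻¹ * z := by
        gcongr
        rw [one_div]
        gcongr
        nlinarith
  have hτ8 : (16 * G)⁻¹ ≤ 1 / 8 := by
    rw [one_div]; gcongr; linarith
  obtain ⟨h1, h2⟩ := abs_log_paretoLaplace_sub_le (R := 2 ^ (7 * w)) (by positivity) hz0 hlog
    (by linarith) hτ8 hτ hRτ
  refine ⟨h1, h2.trans ?_⟩
  gcongr
  rw [mul_inv]
  have : 0 < G⁻¹ := by positivity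
  linarith

/-- The increments of the counters for an update: one counter for the `ℓ₁` norm, and one for every
linear sketch. -/
def counterWeight {n M k N R : ℕ} (o : Fin k → Fin n → Fin N → Fin R) :
    Option (Fin k) → Update n M → ℕ
  | none, x => x.2
  | some j, x => x.2 * sketchWeight (o j) x.1

theorem sum_counterWeight_none {n M k N R L : ℕ} (o : Fin k → Fin n → Fin N → Fin R)
    (σ : Fin L → Update n M) : ∑ t, counterWeight o none (σ t) = l1 (freq σ) :=
  (l1_freq σ).symm

theorem sum_counterWeight_some {n M k N R L : ℕ} (o : Fin k → Fin n → Fin N → Fin R)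
    (σ : Fin L → Update n M) (j : Fin k) :
    ∑ t, counterWeight o (some j) (σ t) = sketch (freq σ) (o j) :=
  (sum_mul_freq σ (sketchWeight (o j))).symm

/-- The entropy estimate from the contents of the counters. -/
noncomputable def entropyEstimate (k N : ℕ) (a : Option (Fin k) → ℝ) : ℝ :=
  -Real.log ((∑ j, Real.exp (-(1 / (N * a none) * a (some j)))) / k) - Real.log N

theorem abs_entropyEstimate_sub_le {n g w v k : ℕ} (hg : 5 ≤ g) (hgw : g + 9 ≤ w)
    (hv : w < 2 ^ v) (hk : 0 < k) {x : Fin n → ℕ} (hx : x ≠ 0) (hF : l1 x ≤ 2 ^ w)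
    (S : Fin k → ℕ) (a : Option (Fin k) → ℝ)
    (hnone : |a none - l1 x| ≤ (2 ^ (g + v + 6))⁻¹ * l1 x)
    (hsome : ∀ j, |a (some j) - S j| ≤ (2 ^ (g + v + 6))⁻¹ * S j)
    (havg : |(∑ j, Real.exp (-(1 / ((2 ^ (4 * w) : ℕ) * l1 x) * S j))) / k
      - Real.exp (-entropy x - Real.log (2 ^ (4 * w) : ℕ))|
      ≤ 3 * (2 ^ g)⁻¹ * Real.exp (-entropy x - Real.log (2 ^ (4 * w) : ℕ))) :
    |entropyEstimate k (2 ^ (4 * w)) a - entropy x| ≤ 16 * (2 ^ g)⁻¹ := by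
  have hF0 : (0 : ℝ) < l1 x := by exact_mod_cast l1_pos hx
  have hη : (2 ^ (g + v + 6) : ℝ)⁻¹ ≤ 1 / 64 := by
    rw [one_div]
    gcongr
    calc (64 : ℝ) = 2 ^ 6 := by norm_num
      _ ≤ _ := pow_le_pow_right₀ (by norm_num) (by omega)
  set η : ℝ := (2 ^ (g + v + 6))⁻¹ with hη_def
  have hη0 : 0 < η := by positivity
  set N : ℕ := 2 ^ (4 * w) with hN
  have hN0 : (0 : ℝ) < N := by positivity
  set μ := Real.exp (-entropy x - Real.log N) with hμ
  have hYeq : ∀ (p q : ℝ), 1 / (N * p) * q = (q / p) / N := by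
    intro p q; rw [div_div, one_div_mul_eq_div, mul_comm p]
  -- A quotient of two counters has relative error `4 η`. The threshold `12 w` works since `exp (-6
  -- w)` lies below `2 ^ (-g) μ`, where `g ≤ w`, `H ≤ w log 2` and `log N = 4 w log 2`. The `v` in
  -- the counter precision pays for the factor `w < 2 ^ v` in `T`.
  have key := abs_log_average_sub_le hk (Y := fun j => 1 / (N * l1 x) * S j)
    (Y' := fun j => 1 / (N * a none) * a (some j)) (κ := 4 * η) (T := 12 * w) (e := (2 ^ g)⁻¹)
    (μ := μ) (fun j => by positivity) (by positivity) (by linarith) ?_ ?_ (by positivity) ?_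
    (Real.exp_pos _) ?_ havg
  · rw [hμ, Real.log_exp, abs_sub_comm] at key
    refine le_trans (le_of_eq ?_) key
    rw [entropyEstimate]
    congr 1
    ring
  · intro j
    rw [hYeq, hYeq, ← sub_div, abs_div, abs_of_pos hN0, ← mul_div_assoc]
    gcongr
    exact abs_div_sub_div_le (by positivity) hF0 hη0.le (by linarith) (hsome j) hnone
  · have hwv : (w : ℝ) ≤ 2 ^ v := by exact_mod_cast hv.le
    have : η = (2 ^ g)⁻¹ * (2 ^ v)⁻¹ * 64⁻¹ := by
      rw [hη_def, pow_add, pow_add, mul_inv, mul_inv]; norm_num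
    have h2 : (2 ^ v : ℝ)⁻¹ * w ≤ 1 := by
      rw [inv_mul_le_iff₀ (by positivity)]; linarith
    have h3 : (0 : ℝ) < (2 ^ g)⁻¹ := by positivity
    calc 4 * η * (12 * w) = (48 / 64) * ((2 ^ g)⁻¹ * ((2 ^ v)⁻¹ * w)) := by rw [this]; ring
      _ ≤ 1 * ((2 ^ g)⁻¹ * 1) := by gcongr; norm_num
      _ = _ := by ring
  · rw [one_div]
    gcongr
    calc (32 : ℝ) = 2 ^ 5 := by norm_num
      _ ≤ _ := pow_le_pow_right₀ (by norm_num) hg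
  · have h1 : entropy x ≤ w * Real.log 2 := by
      refine (entropy_le_log hx).trans ?_
      rw [← Real.log_pow]
      exact Real.log_le_log hF0 (by exact_mod_cast hF)
    have h2 : (2 ^ g : ℝ)⁻¹ = Real.exp (-(g * Real.log 2)) := by
      rw [Real.exp_neg, Real.exp_nat_mul, Real.exp_log (by norm_num)]
    rw [h2, hμ, ← Real.exp_add, Real.exp_le_exp]
    have h3 : Real.log N = 4 * w * Real.log 2 := by
      rw [hN]; push_cast; rw [Real.log_pow]; push_cast; ring
    rw [h3]
    have h4 := Real.log_two_lt_d9
    have h5 := Real.log_two_gt_d9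
    have h6 : (g : ℝ) ≤ w := by exact_mod_cast (by omega : g ≤ w)
    have h7 : (0 : ℝ) ≤ w := by positivity
    nlinarith

/-- The case `a = 1` gives the mean up to a relative bias `2 e`, with `e = 2 ^ (-g)`, and `a = 2`
gives a second moment at most `8 μ²`. Chebyshev with deviation `e μ` and `64 / e²` copies fails with
probability at most `8 / 64`. -/
theorem expect_sketch_bad_le {n g w : ℕ} (hg : 5 ≤ g) (hgw : g + 9 ≤ w) {x : Fin n → ℕ}
    (hx : x ≠ 0) (hF : l1 x ≤ 2 ^ w) :
    𝔼 o : Fin (2 ^ (2 * g + 6)) → Fin n → Fin (2 ^ (4 * w)) → Fin (2 ^ (7 * w)),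
      (if 3 * (2 ^ g)⁻¹ * Real.exp (-entropy x - Real.log (2 ^ (4 * w) : ℕ))
          < |(∑ j, Real.exp (-(1 / ((2 ^ (4 * w) : ℕ) * l1 x) * sketch x (o j))))
              / (2 ^ (2 * g + 6) : ℕ) - Real.exp (-entropy x - Real.log (2 ^ (4 * w) : ℕ))|
        then (1 : ℝ) else 0) ≤ 1 / 8 := by
  have he32 : (2 ^ g : ℝ)⁻¹ ≤ 1 / 32 := by
    rw [one_div]
    gcongr
    calc (32 : ℝ) = 2 ^ 5 := by norm_num
      _ ≤ _ := pow_le_pow_right₀ (by norm_num) hg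
  have hkk : ((2 ^ (2 * g + 6) : ℕ) : ℝ) = 64 / ((2 ^ g : ℝ)⁻¹) ^ 2 := by
    push_cast
    rw [pow_add, pow_mul, inv_pow, div_inv_eq_mul, ← pow_mul, ← pow_mul, mul_comm g]
    norm_num
    ring
  obtain ⟨r1, hr1, h1⟩ := expect_exp_neg_sketch_eq (a := 1) (τ := (2 ^ g)⁻¹) hx
    (N := 2 ^ (4 * w)) (R := 2 ^ (7 * w)) (by positivity) (by positivity) one_pos
    (fun i hi => paretoLaplace_estimate hgw hF hi (le_l1 x i) le_rfl one_le_two)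
  obtain ⟨r2, hr2, h2⟩ := expect_exp_neg_sketch_eq (a := 2) (τ := (2 ^ g)⁻¹) hx
    (N := 2 ^ (4 * w)) (R := 2 ^ (7 * w)) (by positivity) (by positivity) two_pos
    (fun i hi => paretoLaplace_estimate hgw hF hi (le_l1 x i) one_le_two le_rfl)
  set e : ℝ := (2 ^ g)⁻¹ with he_def
  have he0 : 0 < e := by positivity
  set N : ℕ := 2 ^ (4 * w)
  set μ := Real.exp (-entropy x - Real.log N) with hμ
  have hμ0 : 0 < μ := Real.exp_pos _
  have h1' : 𝔼 ω : Fin n → Fin N → Fin (2 ^ (7 * w)), Real.exp (-(1 / (N * l1 x) * sketch x ω))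
      = μ * Real.exp r1 := by
    rw [h1, hμ, ← Real.exp_add, Real.log_one]; congr 1; ring
  have h2' : 𝔼 ω : Fin n → Fin N → Fin (2 ^ (7 * w)),
      Real.exp (-(1 / (N * l1 x) * sketch x ω)) ^ 2 ≤ 8 * μ ^ 2 := by
    have : ∀ ω : Fin n → Fin N → Fin (2 ^ (7 * w)),
        Real.exp (-(1 / (N * l1 x) * sketch x ω)) ^ 2
          = Real.exp (-(2 / (N * l1 x) * sketch x ω)) := by
      intro ω
      rw [← Real.exp_nat_mul]; congr 1; push_cast; ring
    simp_rw [this]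
    rw [h2]
    have h4 : Real.exp (2 * (Real.log 2 - entropy x - Real.log N) + r2)
        = 4 * μ ^ 2 * Real.exp r2 := by
      have : (4 : ℝ) = Real.exp (Real.log 2) ^ 2 := by
        rw [Real.exp_log (by norm_num)]; norm_num
      rw [this, hμ, ← Real.exp_nat_mul, ← Real.exp_nat_mul, ← Real.exp_add, ← Real.exp_add]
      congr 1; push_cast; ring
    rw [h4]
    have h5 := Real.abs_exp_sub_one_le (x := r2) (by linarith)
    have h6 := (abs_le.1 h5).2
    nlinarith [sq_nonneg μ]
  have : Nonempty (Fin n → Fin N → Fin (2 ^ (7 * w))) :=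
    ⟨fun _ _ => ⟨0, by positivity⟩⟩
  have key := expect_average_bad_le
    (fun ω : Fin n → Fin N → Fin (2 ^ (7 * w)) => Real.exp (-(1 / (N * l1 x) * sketch x ω)))
    (k := 2 ^ (2 * g + 6)) (by positivity) (t := e * μ) (by positivity) h2'
  refine le_trans (Finset.expect_le_expect fun o _ => ?_) (key.trans ?_)
  · rw [h1']
    have h7 : |μ * Real.exp r1 - μ| ≤ 2 * e * μ := by
      have h5 := Real.abs_exp_sub_one_le (x := r1) (by linarith)
      have : μ * Real.exp r1 - μ = μ * (Real.exp r1 - 1) := by ring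
      rw [this, abs_mul, abs_of_pos hμ0]
      nlinarith
    split_ifs with hA hB hB
    · exact le_rfl
    · exfalso
      have := abs_sub_le ((∑ j, Real.exp (-(1 / (N * l1 x) * sketch x (o j))))
        / (2 ^ (2 * g + 6) : ℕ)) (μ * Real.exp r1) μ
      linarith
    · exact zero_le_one
    · exact le_rfl
  · rw [hkk]
    apply le_of_eq
    field_simp
    norm_num

theorem card_counters_le {β w v k : ℕ} (hv : w < 2 ^ v) :
    Fintype.card (Option (Fin k) → CounterState β (12 * w)) ≤ 2 ^ ((β + v + 5) * (k + 1)) := by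
  have h1 : 1 ≤ 2 ^ β := Nat.one_le_two_pow
  have h2 : Fintype.card (CounterState β (12 * w)) ≤ 2 ^ (β + v + 5) := by
    refine (card_counterState_le _ _).trans ?_
    have : 2 ^ (β + v + 5) = (2 * 2 ^ β) * (16 * 2 ^ v) := by rw [pow_add, pow_add]; ring
    rw [this]
    exact Nat.mul_le_mul (by omega) (by omega)
  calc _ = Fintype.card (CounterState β (12 * w)) ^ (k + 1) := by simp
    _ ≤ (2 ^ (β + v + 5)) ^ (k + 1) := Nat.pow_le_pow_left h2 _
    _ = _ := by rw [← pow_mul]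

theorem expect_counter_bad_le_of_params {g v β E L : ℕ} (hβ : 4 * g + 2 * v + 23 ≤ β)
    (w : Fin L → ℕ) (hS : 0 < ∑ t, w t) :
    𝔼 u, (if (2 ^ (g + v + 6))⁻¹ * ∑ t, (w t : ℝ) < |(counter β E w u 0 : ℝ) - ∑ t, (w t : ℝ)|
      then (1 : ℝ) else 0) ≤ 1 / (16 * 2 ^ (2 * g + 6)) := by
  refine (expect_counter_bad_le (by omega) w (by positivity) hS).trans ?_
  have h1 : (2 : ℝ) ^ (4 * g + 2 * v + 23) ≤ 2 ^ β := pow_le_pow_right₀ (by norm_num) hβ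
  rw [div_div, div_le_div_iff₀ (by positivity) (by positivity), inv_pow]
  have h2 : (2 : ℝ) ^ (4 * g + 2 * v + 23)
      = 2 * (16 * 2 ^ (2 * g + 6)) * (2 ^ (g + v + 6)) ^ 2 := by
    ring
  rw [h2] at h1
  have h3 : (0 : ℝ) < (2 ^ (g + v + 6)) ^ 2 := by positivity
  calc (2 : ℝ) * (16 * 2 ^ (2 * g + 6))
      = 2 * (16 * 2 ^ (2 * g + 6)) * (2 ^ (g + v + 6)) ^ 2 * ((2 ^ (g + v + 6)) ^ 2)⁻¹ := by
        field_simp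
    _ ≤ 2 ^ β * ((2 ^ (g + v + 6)) ^ 2)⁻¹ := by gcongr
    _ = 1 * _ := by rw [one_mul]

theorem exists_entropy_algorithm {n m M g w v : ℕ} (hg : 5 ≤ g) (hgw : g + 9 ≤ w)
    (hv : w < 2 ^ v) (hmM : m * M ≤ 2 ^ w) :
    ∃ A : Algorithm n M ((4 * g + 3 * v + 28) * (2 ^ (2 * g + 6) + 1)),
      ∀ (L : ℕ), L ≤ m → ∀ σ : Fin L → Update n M, freq σ ≠ 0 →
        3 / 4 ≤ A.prob {ρ : A.Randomness L |
          |A.estimate ρ σ - entropy (freq σ)| ≤ 16 * (2 ^ g)⁻¹} := by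
  classical
  set k := 2 ^ (2 * g + 6) with hk
  set N := 2 ^ (4 * w) with hN
  set R := 2 ^ (7 * w) with hR
  set β := 4 * g + 2 * v + 23 with hβ
  have hbits : (4 * g + 3 * v + 28) = β + v + 5 := by omega
  rw [hbits]
  have hk0 : 0 < k := by positivity
  have hO : Fintype.card (Fin k → Fin n → Fin N → Fin R) = 2 ^ (7 * w * N * n * k) := by
    simp only [Fintype.card_fun, Fintype.card_fin, hR, ← pow_mul]
  -- All counters share the coins of an update: only a union bound over the counters is used, so
  -- they need not be independent. The cap exponent `12 w` comes from `F N R ≤ 2 ^ (w + 4 w + 7 w)`.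
  obtain ⟨A, hA⟩ := exists_algorithm (n := n) (M := M) (card_counters_le (β := β) (k := k) hv) hO
    (Fintype.card_fin (2 ^ (12 * w))) (fun _ => 0)
    (fun o u st x j => (st j).add (counterWeight o j x) u)
    (fun _ st => entropyEstimate k N fun j => ((st j : ℕ) : ℝ))
  refine ⟨A, fun L hL σ hσ => ?_⟩
  have hF : l1 (freq σ) ≤ 2 ^ w :=
    (l1_freq_le σ).trans ((Nat.mul_le_mul_right M hL).trans hmM)
  rw [hA L σ fun y => |y - entropy (freq σ)| ≤ 16 * (2 ^ g)⁻¹]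
  set x := freq σ with hx
  set μ := Real.exp (-entropy x - Real.log N) with hμ
  set B1 : (Fin k → Fin n → Fin N → Fin R) → ℝ := fun o =>
    if 3 * (2 ^ g)⁻¹ * μ < |(∑ j, Real.exp (-(1 / (N * l1 x) * sketch x (o j)))) / k - μ|
      then 1 else 0 with hB1
  set W : (Fin k → Fin n → Fin N → Fin R) → Option (Fin k) → Fin L → ℕ := fun o j t =>
    counterWeight o j (σ t) with hW
  set B2 : (Fin k → Fin n → Fin N → Fin R) → (Fin L → Fin (2 ^ (12 * w))) → Option (Fin k) → ℝ :=
    fun o u j => if (2 ^ (g + v + 6))⁻¹ * ∑ t, (W o j t : ℝ)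
      < |(counter β (12 * w) (W o j) u 0 : ℝ) - ∑ t, (W o j t : ℝ)| then 1 else 0 with hB2
  have hWpos : ∀ o j, 0 < ∑ t, W o j t := by
    intro o j
    cases j with
    | none => rw [hW, sum_counterWeight_none]; exact l1_pos hσ
    | some j => rw [hW, sum_counterWeight_some]; exact sketch_pos hσ (by positivity) _
  have hWle : ∀ o j, ∑ t, W o j t ≤ 2 ^ (12 * w) := by
    intro o j
    cases j with
    | none =>
      rw [hW, sum_counterWeight_none]
      exact hF.trans (Nat.pow_le_pow_right (by norm_num) (by omega))
    | some j =>
      rw [hW, sum_counterWeight_some]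
      refine (sketch_le _ _).trans ((Nat.mul_le_mul_right _ hF).trans (le_of_eq ?_))
      rw [hN, hR, ← pow_add, ← pow_add]
      congr 1; ring
  -- The union bound in pointwise form: if neither the sketches nor any counter fail, the estimate
  -- is accurate.
  have hgood : ∀ o u, 1 - B1 o - ∑ j, B2 o u j
      ≤ if |entropyEstimate k N (fun j => ((Fin.foldl L (fun (st : Option (Fin k) →
          CounterState β (12 * w)) t => fun j => (st j).add (counterWeight o j (σ t)) (u t))
          (fun _ => 0) j : ℕ) : ℝ)) - entropy x| ≤ 16 * (2 ^ g)⁻¹ then (1 : ℝ) else 0 := by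
    intro o u
    have hB1n : 0 ≤ B1 o := by simp only [hB1]; split_ifs <;> norm_num
    have hB2n : ∀ j, 0 ≤ B2 o u j := fun j => by simp only [hB2]; split_ifs <;> norm_num
    have hB2s : 0 ≤ ∑ j, B2 o u j := sum_nonneg fun j _ => hB2n j
    split_ifs with hgd
    · linarith
    by_contra hcon
    have hlt : B1 o + ∑ j, B2 o u j < 1 := by linarith
    apply hgd
    have hb1 : |(∑ j, Real.exp (-(1 / (N * l1 x) * sketch x (o j)))) / k - μ|
        ≤ 3 * (2 ^ g)⁻¹ * μ := by
      by_contra hc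
      have : B1 o = 1 := if_pos (not_le.1 hc)
      linarith
    have hb2 : ∀ j, |(counter β (12 * w) (W o j) u 0 : ℝ) - ∑ t, (W o j t : ℝ)|
        ≤ (2 ^ (g + v + 6))⁻¹ * ∑ t, (W o j t : ℝ) := by
      intro j
      by_contra hc
      have h1 : B2 o u j = 1 := if_pos (not_le.1 hc)
      have h2 := single_le_sum (f := B2 o u) (fun j _ => hB2n j) (mem_univ j)
      linarith
    have hst : ∀ j, ((Fin.foldl L (fun (st : Option (Fin k) →
          CounterState β (12 * w)) t => fun j => (st j).add (counterWeight o j (σ t)) (u t))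
          (fun _ => 0) j : ℕ) : ℝ) = counter β (12 * w) (W o j) u 0 := by
      intro j
      rw [foldl_pi (fun j (a : CounterState β (12 * w)) t =>
        a.add (counterWeight o j (σ t)) (u t)), coe_foldl_add, min_eq_left]
      have h1 : (2 ^ (g + v + 6) : ℝ)⁻¹ ≤ 1 := inv_le_one_of_one_le₀ (one_le_pow₀ (by norm_num))
      have h2 : ∑ t, (W o j t : ℝ) ≤ 2 ^ (12 * w) := by exact_mod_cast hWle o j
      have h3 : (0 : ℝ) ≤ ∑ t, (W o j t : ℝ) := by positivity
      have h4 := (abs_le.1 (hb2 j)).2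
      -- An accurate counter is at most twice its true value, hence below the cap, so saturation has
      -- no effect.
      have h5 : (counter β (12 * w) (W o j) u 0 : ℝ) ≤ 2 ^ (β + 12 * w) := by
        have h6 : (2 : ℝ) * 2 ^ (12 * w) ≤ 2 ^ (β + 12 * w) := by
          rw [← pow_succ']
          exact pow_le_pow_right₀ (by norm_num) (by omega)
        nlinarith
      exact_mod_cast h5
    simp_rw [hst]
    refine abs_entropyEstimate_sub_le hg hgw hv hk0 hσ hF (fun j => sketch x (o j)) _ ?_ ?_ hb1
    · have := hb2 none
      have e : ∑ t, (W o none t : ℝ) = l1 x := by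
        exact_mod_cast sum_counterWeight_none o σ
      rwa [e] at this
    · intro j
      have := hb2 (some j)
      have e : ∑ t, (W o (some j) t : ℝ) = sketch x (o j) := by
        exact_mod_cast sum_counterWeight_some o σ j
      rwa [e] at this
  have : Nonempty (Fin R) := ⟨⟨0, by positivity⟩⟩
  have hE1 : 𝔼 o, B1 o ≤ 1 / 8 := expect_sketch_bad_le hg hgw hσ hF
  have hE2 : ∀ o, 𝔼 u, ∑ j, B2 o u j ≤ 1 / 8 := by
    intro o
    rw [Finset.expect_sum_comm]
    calc ∑ j, 𝔼 u, B2 o u j ≤ ∑ _j : Option (Fin k), 1 / (16 * 2 ^ (2 * g + 6) : ℝ) :=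
          sum_le_sum fun j _ => expect_counter_bad_le_of_params le_rfl (W o j) (hWpos o j)
      _ = (k + 1) / (16 * k) := by
          rw [sum_const, card_univ, Fintype.card_option, Fintype.card_fin, nsmul_eq_mul, hk]
          push_cast
          ring
      _ ≤ 1 / 8 := by
          have : (1 : ℝ) ≤ k := by exact_mod_cast hk0
          rw [div_le_div_iff₀ (by positivity) (by positivity)]
          linarith
  calc (3 / 4 : ℝ) ≤ 𝔼 o, (1 - B1 o - 1 / 8) := by
        rw [Finset.expect_sub_distrib, Finset.expect_sub_distrib, Fintype.expect_const,
          Fintype.expect_const]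
        linarith
    _ ≤ 𝔼 o, 𝔼 u, (1 - B1 o - ∑ j, B2 o u j) := by
        refine Finset.expect_le_expect fun o _ => ?_
        rw [Finset.expect_sub_distrib, Fintype.expect_const]
        linarith [hE2 o]
    _ ≤ _ := Finset.expect_le_expect fun o _ => Finset.expect_le_expect fun u _ => hgood o u

/-! ### Choice of parameters and the space bound -/

theorem Algorithm.prob_mono {n M s : ℕ} (A : Algorithm n M s) {L : ℕ} {E E' : Set (A.Randomness L)}
    (h : E ⊆ E') : A.prob E ≤ A.prob E' := by
  unfold Algorithm.prob
  gcongr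
  exact Nat.card_mono (Set.toFinite _) h

theorem le_of_two_pow_le {k : ℕ} {x : ℝ} (h : 2 ^ k ≤ x) : (k : ℝ) ≤ 2 * Real.log x := by
  have h1 := Real.log_le_log (by positivity) h
  rw [Real.log_pow] at h1
  have h2 := Real.log_two_gt_d9
  have : (0 : ℝ) ≤ k := by positivity
  nlinarith

theorem exists_two_pow_between {x : ℝ} (hx : 1 < x) :
    ∃ k : ℕ, x < 2 ^ k ∧ (2 : ℝ) ^ k ≤ 2 * x := by
  obtain ⟨k, hk1, hk2⟩ := exists_nat_pow_near hx.le one_lt_two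
  exact ⟨k + 1, hk2, by rw [pow_succ]; linarith⟩

/-- Here `2 ^ g` is of order `1 / ε`, `w` is `O(log n + log (1 / ε))` and `2 ^ v` is of order `w`.
So `g` and `v` are `O(log log n + log (1 / ε))`, and the number of counters is `O(1 / ε²)`. -/
theorem exists_params (c : ℕ) :
    ∃ C : ℝ, 0 < C ∧ ∀ (n : ℕ) (ε : ℝ), 3 ≤ n → 0 < ε → ε < 1 → ∃ g w v : ℕ,
      5 ≤ g ∧ g + 9 ≤ w ∧ w < 2 ^ v ∧ n ^ c * n ^ c ≤ 2 ^ w ∧ 16 * (2 ^ g : ℝ)⁻¹ ≤ ε ∧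
      (((4 * g + 3 * v + 28) * (2 ^ (2 * g + 6) + 1) : ℕ) : ℝ)
        ≤ C * (1 / ε ^ 2 * (Real.log (Real.log n) + Real.log (1 / ε))) := by
  have hl3 : 1 < Real.log 3 := by
    rw [Real.lt_log_iff_exp_lt (by norm_num)]
    linarith [Real.exp_one_lt_d9]
  have hc0 : 0 < Real.log (Real.log 3) := Real.log_pos hl3
  set c₀ := Real.log (Real.log 3) with hc₀
  set D : ℝ := 6 * c + 41 with hD
  have hD1 : 1 ≤ D := by rw [hD]; linarith [(Nat.cast_nonneg c : (0 : ℝ) ≤ c)]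
  set K : ℝ := 8 * Real.log 32 + 6 * Real.log (2 * D) + 28 with hK
  have hK0 : 0 ≤ K := by
    have h1 : 0 ≤ Real.log 32 := Real.log_nonneg (by norm_num)
    have h2 : 0 ≤ Real.log (2 * D) := Real.log_nonneg (by linarith)
    rw [hK]; positivity
  refine ⟨(14 + K / c₀) * 65537, by positivity, fun n ε hn hε hε1 => ?_⟩
  have hn3 : (3 : ℝ) ≤ n := by exact_mod_cast hn
  have hlogn : Real.log 3 ≤ Real.log n := Real.log_le_log (by norm_num) hn3
  -- This is where `n ≥ 3` enters: `log log n` is bounded below by a positive constant, so additive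
  -- constants such as `K` can be absorbed.
  have hlln : c₀ ≤ Real.log (Real.log n) := Real.log_le_log (by linarith) hlogn
  have hε' : 1 < 1 / ε := by rw [lt_div_iff₀ hε]; linarith
  have hlε : 0 < Real.log (1 / ε) := Real.log_pos hε'
  obtain ⟨g, hg1, hg2⟩ := exists_two_pow_between (x := 16 * (1 / ε)) (by linarith)
  obtain ⟨a, ha1, ha2⟩ := exists_two_pow_between (x := n) (by linarith)
  have hg5 : 5 ≤ g := by
    have : (2 : ℝ) ^ 4 < 2 ^ g := by linarith
    have := (pow_lt_pow_iff_right₀ (one_lt_two (α := ℝ))).1 this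
    omega
  set w := 2 * c * a + g + 9 with hw
  have hw0 : (1 : ℝ) < w := by exact_mod_cast (by omega : 1 < w)
  obtain ⟨v, hv1, hv2⟩ := exists_two_pow_between hw0
  have hgε : (g : ℝ) ≤ 2 * (Real.log 32 + Real.log (1 / ε)) := by
    rw [← Real.log_mul (by norm_num) (by positivity)]
    exact le_of_two_pow_le (by linarith)
  have haln : (a : ℝ) ≤ 3 * Real.log n := by
    have h1 := Real.log_le_log (by positivity) ha2
    rw [Real.log_pow, Real.log_mul (by norm_num) (by linarith)] at h1
    have h2 := Real.log_two_gt_d9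
    have h3 := Real.log_two_lt_d9
    have : (0 : ℝ) ≤ a := by positivity
    nlinarith
  have hwq : (w : ℝ) ≤ D * (Real.log n * (1 / ε)) := by
    have h1 : (g : ℝ) ≤ 32 * (1 / ε) := by
      have := le_two_pow_self g
      linarith
    have h2 : 1 / ε ≤ Real.log n * (1 / ε) := le_mul_of_one_le_left (by positivity) (by linarith)
    have h3 : Real.log n ≤ Real.log n * (1 / ε) := le_mul_of_one_le_right (by linarith) hε'.le
    have h4 : (c : ℝ) * a ≤ c * (3 * (Real.log n * (1 / ε))) := by gcongr; linarith
    rw [hw, hD]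
    push_cast
    nlinarith
  set ℓ := Real.log (Real.log n) + Real.log (1 / ε) with hℓ
  have hvℓ : (v : ℝ) ≤ 2 * (Real.log (2 * D) + ℓ) := by
    rw [hℓ, ← Real.log_mul (by linarith) (by positivity),
      ← Real.log_mul (by positivity) (mul_pos (by linarith) (by positivity)).ne']
    exact le_of_two_pow_le (by linarith)
  have hbits : (4 * g + 3 * v + 28 : ℝ) ≤ (14 + K / c₀) * ℓ := by
    have h1 : K ≤ K / c₀ * ℓ := by
      rw [div_mul_eq_mul_div, le_div_iff₀ hc0]
      exact mul_le_mul_of_nonneg_left (by linarith) hK0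
    rw [add_mul]
    linarith
  have hcopies : (2 ^ (2 * g + 6) + 1 : ℝ) ≤ 65537 * (1 / ε ^ 2) := by
    have h1 : (2 ^ g : ℝ) ^ 2 ≤ (2 * (16 * (1 / ε))) ^ 2 := by gcongr
    have h2 : (2 : ℝ) ^ (2 * g + 6) = 64 * (2 ^ g) ^ 2 := by ring
    have h3 : (2 * (16 * (1 / ε))) ^ 2 = 1024 * (1 / ε ^ 2) := by ring
    have h4 : 1 ≤ 1 / ε ^ 2 := by
      rw [le_div_iff₀ (by positivity)]; nlinarith
    rw [h2]
    linarith
  refine ⟨g, w, v, hg5, by omega, ?_, ?_, ?_, ?_⟩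
  · exact_mod_cast hv1
  · have h1 : n ≤ 2 ^ a := by exact_mod_cast ha1.le
    calc n ^ c * n ^ c = n ^ (2 * c) := by ring
      _ ≤ (2 ^ a) ^ (2 * c) := Nat.pow_le_pow_left h1 _
      _ = 2 ^ (2 * c * a) := by rw [← pow_mul, mul_comm]
      _ ≤ 2 ^ w := Nat.pow_le_pow_right (by norm_num) (by omega)
  · rw [mul_inv_le_iff₀ (by positivity)]
    have : 16 * (1 / ε) * ε ≤ 2 ^ g * ε := by gcongr
    rw [mul_assoc, one_div_mul_cancel hε.ne'] at this
    linarith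
  · have : 0 ≤ (14 + K / c₀) * ℓ := le_trans (by positivity) hbits
    push_cast
    calc (4 * g + 3 * v + 28 : ℝ) * (2 ^ (2 * g + 6) + 1)
        ≤ ((14 + K / c₀) * ℓ) * (65537 * (1 / ε ^ 2)) := by gcongr
      _ = _ := by ring

end EntropyStream

theorem theorem5p4 (c : ℕ) :
    ∃ C : ℝ, 0 < C ∧ ∀ (n m M : ℕ) (ε : ℝ), 3 ≤ n → m ≤ n ^ c → M ≤ n ^ c → 0 < ε → ε < 1 →
      ∃ (s : ℕ) (A : EntropyStream.Algorithm n M s),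
        (s : ℝ) ≤ C * (1 / ε ^ 2 * (Real.log (Real.log n) + Real.log (1 / ε))) ∧
        ∀ (L : ℕ), L ≤ m → ∀ σ : Fin L → EntropyStream.Update n M,
          EntropyStream.freq σ ≠ 0 →
            3 / 4 ≤ A.prob {ρ : A.Randomness L |
              |A.estimate ρ σ - EntropyStream.entropy (EntropyStream.freq σ)| ≤ ε} := by
  obtain ⟨C, hC, h⟩ := EntropyStream.exists_params c
  refine ⟨C, hC, fun n m M ε hn hm hM hε hε1 => ?_⟩
  obtain ⟨g, w, v, hg, hgw, hv, hnw, hgε, hs⟩ := h n ε hn hε hε1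
  obtain ⟨A, hA⟩ := EntropyStream.exists_entropy_algorithm (n := n) hg hgw hv
    ((Nat.mul_le_mul hm hM).trans hnw)
  exact ⟨_, A, hs, fun L hL σ hσ => (hA L hL σ hσ).trans
    (A.prob_mono fun ρ hρ => le_trans hρ hgε)⟩
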